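/- Let $d\in\{2,3\}$, $\mathbb T^d=\mathbb R^d/\mathbb Z^d$, and $e_k(x)=e^{2\pi i k\cdot x}$. For $s\in\mathbb R$ let $H^s$ be the space of real zero-mean vector fields (formal Fourier series) $u=\sum_{k\in\mathbb Z^d\setminus\{0\}}\hat u_k e_k$, $\hat u_k\in\mathbb C^d$, $\overline{\hat u_k}=\hat u_{-k}$, with $\|u\|_{H^s}^2=\sum_{k\ne0}|2\pi k|^{2s}|\hat u_k|^2<\infty$; let $H_\sigma$ be the subspace of divergence-free fields ($k\cdot\hat u_k=0$) of $H^0$, with $\|\cdot\|_{L^2}=\|\cdot\|_{H^0}$. Let $\Pi$ be the Helmholtz–Leray projection, $(\Pi u)^\wedge_k=\hat u_k-\frac{k\cdot\hat u_k}{|k|^2}k$ for $k\neq 0$ (spatial means are discarded). Let $\kappa>0$, $\frac{d-2}4<\gamma_0<\frac{d+2}4$, $0<\gamma<\frac d2$ and $\frac d2-\gamma<\beta<(2\gamma_0)\wedge\frac d2$. Put $K=(1+(-\Delta)^{\gamma_0})^{-1}$, i.e. $(Ku)^\wedge_k=\hat u_k/(1+|2\pi k|^{2\gamma_0})$, and $P_t=e^{C_d'\kappa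 t\Delta}$ with $C_2'=\frac14$, $C_3'=\frac35$. Then there exist $q>\max\{2,\frac{4}{4\gamma_0-d+2}\}$, $C>0$ and $M>0$, depending only on $d,\kappa,\gamma_0,\gamma,\beta$, such that the following holds for all $T>0$, all $u_0\in H_\sigma$ and the solution $\tilde u\in C([0,T];H_\sigma)\cap L^2(0,T;H^1)$ of the viscous Leray-$\alpha$ model $\partial_t\tilde u+\Pi(K(\tilde u)\cdot\nabla\tilde u)=C_d'\kappa\Delta\tilde u$, $\tilde u_0=u_0$, understood in the mild form $$\tilde u_t=P_tu_0-\int_0^tP_{t-s}\Pi\big(K(\tilde u_s)\cdot\nabla\tilde u_s\big)\,ds ,\qquad t\in[0,T].$$ For every $z\in C([0,T];H^{-\beta})$ there is a unique $y\in C([0,T];H^{-\beta})$ with $$y_t=-\int_0^tP_{t-s}\,\Pi\big[K(y_s)\cdot\nabla\tilde u_s+K(\tilde u_s)\cdot\nabla y_s\big]\,ds+z_t ,\qquad t\in[0,T].$$ The solution map $S:z\mapsto y$ is a bounded linear operator on $C([0,T];H^{-\beta})$ (with the supremum norm), and $$\|Sz\|_{C([0,T];H^{-\beta})}\le M\exp\!\big(C(1+T)\|u_0\|_{L^2}^q\big)\,\|z\|_{C([0,T];H^{-\beta})}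 .$$ In both equations the time integrals are taken Fourier coefficient by Fourier coefficient. -/

import Mathlib

open MeasureTheory

noncomputable section

namespace LerayAlpha

/-- The set of nonzero lattice points of `ℤ^d`. -/
abbrev Freq (d : ℕ) : Type := {k : Fin d → ℤ // k ≠ 0}

/-- Formal zero-mean Fourier series `∑_{k ≠ 0} û_k e_k` with `û_k ∈ ℂ^d`, on the torus `ℝ^d/ℤ^d`,
where `e_k(x) = exp(2πi k·x)`. -/
def FourierSeries (d : ℕ) : Type := Freq d → EuclideanSpace ℂ (Fin d)

instance (d : ℕ) : AddCommGroup (FourierSeries d) :=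
  inferInstanceAs (AddCommGroup (Freq d → EuclideanSpace ℂ (Fin d)))

instance (d : ℕ) : Module ℝ (FourierSeries d) :=
  inferInstanceAs (Module ℝ (Freq d → EuclideanSpace ℂ (Fin d)))

variable {d : ℕ}

/-- `|2πk|`, with `|k|` the Euclidean length of `k`. -/
def absFreq (k : Fin d → ℤ) : ℝ := 2 * Real.pi * Real.sqrt (∑ i, (k i : ℝ) ^ 2)

theorem absFreq_pos (k : Freq d) : 0 < absFreq k.1 := by
  have h : ∃ i, k.1 i ≠ 0 := by
    by_contra h
    push Not at h
    exact k.2 (funext h)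
  obtain ⟨i, hi⟩ := h
  have h1 : 0 < ∑ i, (k.1 i : ℝ) ^ 2 :=
    Finset.sum_pos' (fun j _ => sq_nonneg _)
      ⟨i, Finset.mem_univ i, by have : (k.1 i : ℝ) ≠ 0 := by exact_mod_cast hi
                                positivity⟩
  unfold absFreq
  positivity

/-- The `k`-th Fourier coefficient for every `k ∈ ℤ^d`; the coefficient at `k = 0` vanishes. -/
def coeff (u : FourierSeries d) (k : Fin d → ℤ) : EuclideanSpace ℂ (Fin d) :=
  if h : k ≠ 0 then u ⟨k, h⟩ else 0

/-- The series represents an `ℝ^d`-valued field: `û_{-k}` is the complex conjugate of `û_k`. -/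
def IsReal (u : FourierSeries d) : Prop :=
  ∀ (k : Fin d → ℤ) (i : Fin d), coeff u (-k) i = star (coeff u k i)

/-- Divergence free: `k · û_k = 0` for all `k`. -/
def IsDivFree (u : FourierSeries d) : Prop :=
  ∀ k : Freq d, ∑ i, (k.1 i : ℂ) * u k i = 0

/-- The sequence `(|2πk|^s û_k)_k`. -/
def weighted (s : ℝ) (u : FourierSeries d) : Freq d → EuclideanSpace ℂ (Fin d) :=
  fun k => (absFreq k.1 ^ s : ℝ) • u k

/-- The Sobolev space `H^s(𝕋^d; ℝ^d)` of real zero-mean vector fields: the weighted sequence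
`(|2πk|^s û_k)_k` is square summable. -/
def Sobolev (d : ℕ) (s : ℝ) : Submodule ℝ (FourierSeries d) where
  carrier := {u | Memℓp (weighted s u) 2 ∧ IsReal u}
  zero_mem' := by
    refine ⟨?_, ?_⟩
    · have : weighted s (0 : FourierSeries d) = 0 := funext fun k => smul_zero _
      rw [this]
      exact zero_memℓp
    · intro k i
      have h : ∀ k : Fin d → ℤ, coeff (0 : FourierSeries d) k = 0 := by
        intro k
        unfold coeff
        split <;> rfl
      simp [h]
  add_mem' := by
    rintro u v ⟨hu, hu'⟩ ⟨hv, hv'⟩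
    refine ⟨?_, ?_⟩
    · have : weighted s (u + v) = weighted s u + weighted s v :=
        funext fun k => smul_add _ _ _
      rw [this]
      exact hu.add hv
    · intro k i
      have h : ∀ k : Fin d → ℤ, coeff (u + v) k = coeff u k + coeff v k := by
        intro k
        unfold coeff
        split
        · rfl
        · simp
      simp [h, hu' k i, hv' k i]
  smul_mem' := by
    rintro c u ⟨hu, hu'⟩
    refine ⟨?_, ?_⟩
    · have : weighted s (c • u) = c • weighted s u :=
        funext fun k => smul_comm (absFreq k.1 ^ s : ℝ) c (u k)
      rw [this]
      exact hu.const_smul c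
    · intro k i
      have h : ∀ k : Fin d → ℤ, coeff (c • u) k = c • coeff u k := by
        intro k
        unfold coeff
        split
        · rfl
        · simp
      simp [h, hu' k i]

/-- The isometric embedding `u ↦ (|2πk|^s û_k)_k` of `H^s` into `ℓ²`, used to transport the norm. -/
def Sobolev.toL2 (d : ℕ) (s : ℝ) :
    Sobolev d s →ₗ[ℝ] lp (fun _ : Freq d => EuclideanSpace ℂ (Fin d)) 2 where
  toFun u := ⟨weighted s u.1, u.2.1⟩
  map_add' _ _ := Subtype.ext (funext fun _ => smul_add _ _ _)
  map_smul' c u := Subtype.ext (funext fun k => smul_comm (absFreq k.1 ^ s : ℝ) c (u.1 k))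

theorem Sobolev.toL2_injective (d : ℕ) (s : ℝ) : Function.Injective (Sobolev.toL2 d s) := by
  intro u v h
  apply Subtype.ext
  funext k
  have h0 : (Sobolev.toL2 d s u).1 = (Sobolev.toL2 d s v).1 := congrArg Subtype.val h
  have h1 : weighted s u.1 k = weighted s v.1 k := congrFun h0 k
  exact smul_right_injective _ (Real.rpow_pos_of_pos (absFreq_pos k) s).ne' h1

instance (d : ℕ) (s : ℝ) : NormedAddCommGroup (Sobolev d s) :=
  NormedAddCommGroup.induced _ _ (Sobolev.toL2 d s) (Sobolev.toL2_injective d s)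

instance (d : ℕ) (s : ℝ) : NormedSpace ℝ (Sobolev d s) :=
  NormedSpace.induced ℝ _ _ (Sobolev.toL2 d s)

/-- The norm of `H^s`: `‖u‖² = ∑_{k ≠ 0} |2πk|^{2s} |û_k|²`. -/
theorem Sobolev.norm_sq_eq (s : ℝ) (u : Sobolev d s) :
    ‖u‖ ^ 2 = ∑' k : Freq d, absFreq k.1 ^ (2 * s) * ‖u.1 k‖ ^ 2 := by
  have h := lp.norm_rpow_eq_tsum (p := 2) (by norm_num) (Sobolev.toL2 d s u)
  have h0 : ‖u‖ = ‖Sobolev.toL2 d s u‖ := rfl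
  rw [h0]
  norm_num at h
  rw [h]
  refine tsum_congr fun k => ?_
  have h1 : (Sobolev.toL2 d s u).1 k = (absFreq k.1 ^ s : ℝ) • u.1 k := rfl
  rw [h1, norm_smul, mul_pow, Real.norm_of_nonneg (Real.rpow_nonneg (absFreq_pos k).le s), mul_comm 2 s,
    Real.rpow_mul (absFreq_pos k).le]
  norm_num

/-- `‖u‖²_{H^1} ∈ [0, ∞]` for an arbitrary formal series. -/
def sobolevOneSq (u : FourierSeries d) : ENNReal :=
  ∑' k : Freq d, ENNReal.ofReal (absFreq k.1 ^ 2 * ‖u k‖ ^ 2)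

/-- The Helmholtz–Leray projection `û_k ↦ û_k - (k · û_k / |k|²) k`. -/
def leray (u : FourierSeries d) : FourierSeries d := fun k =>
  u k - ((∑ i, (k.1 i : ℂ) * u k i) / (∑ i, (k.1 i : ℂ) ^ 2)) •
    WithLp.toLp 2 (fun i => (k.1 i : ℂ))

/-- `K = (1 + (-Δ)^{γ₀})⁻¹`, the Fourier multiplier `1 / (1 + |2πk|^{2γ₀})`. -/
def smoothing (γ₀ : ℝ) (u : FourierSeries d) : FourierSeries d := fun k =>
  (1 / (1 + absFreq k.1 ^ (2 * γ₀)) : ℝ) • u k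

/-- The transport term `V · ∇f`, with the spatial mean removed: its `k`-th coefficient is
`∑_j 2πi (V̂_j · (k - j)) f̂_{k-j}`. -/
def transport (V f : FourierSeries d) : FourierSeries d := fun k =>
  ∑' j : Fin d → ℤ,
    (2 * Real.pi * Complex.I * ∑ l, coeff V j l * ((k.1 - j) l : ℂ)) • coeff f (k.1 - j)

/-- `C'_d = 1/4` for `d = 2` and `3/5` for `d = 3` (the only dimensions considered). -/
def viscConst (d : ℕ) : ℝ := if d = 2 then 1 / 4 else 3 / 5

/-- The heat semigroup `P_t = exp(C'_d κ t Δ)`. -/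
def heat (κ t : ℝ) (u : FourierSeries d) : FourierSeries d := fun k =>
  Real.exp (-(viscConst d * κ * t * absFreq k.1 ^ 2)) • u k

/-- `y_t = a_t - ∫₀ᵗ P_{t-s} F_s ds` for all `t ∈ [0,T]`, an identity of formal Fourier series:
each Fourier coefficient of the integrand is integrable on `[0,t]`, and the integral is taken
coefficientwise. -/
def SatisfiesDuhamel (κ T : ℝ) (y a : Set.Icc (0 : ℝ) T → FourierSeries d)
    (F : ℝ → FourierSeries d) : Prop :=
  ∀ (t : Set.Icc (0 : ℝ) T) (k : Freq d),
    IntervalIntegrable (fun s => heat κ (t - s) (F s) k) volume 0 t ∧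
    y t k = a t k - ∫ s in (0 : ℝ)..t, heat κ (t - s) (F s) k

/-- `u` is a solution on `[0,T]`, in the energy class `C([0,T]; H_σ) ∩ L²(0,T; H¹)`, of the viscous
Leray-α model `∂ₜu + Π(K(u)·∇u) = C'_d κ Δu`, `u(0) = u₀`, in mild form
`u_t = P_t u₀ - ∫₀ᵗ P_{t-s} Π(K(u_s)·∇u_s) ds`. -/
structure IsLerayAlphaSolution (κ γ₀ T : ℝ) (hT : 0 ≤ T) (u₀ : Sobolev d 0)
    (u : C(Set.Icc (0 : ℝ) T, Sobolev d 0)) : Prop where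
  divFree : ∀ t, IsDivFree (u t).1
  sq_integrable : ∫⁻ s in Set.Icc (0 : ℝ) T, sobolevOneSq (u (Set.projIcc 0 T hT s)).1 < ⊤
  mild : SatisfiesDuhamel κ T (fun t => (u t).1) (fun t => heat κ t u₀.1) (fun s =>
    leray (transport (smoothing γ₀ (u (Set.projIcc 0 T hT s)).1) (u (Set.projIcc 0 T hT s)).1))

/-- `y ∈ C([0,T]; H^{-β})` solves the linear equation
`y_t = -∫₀ᵗ P_{t-s} Π[K(y_s)·∇ũ_s + K(ũ_s)·∇y_s] ds + z_t` on `[0,T]`. -/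
def IsLinearizedSolution (κ γ₀ β T : ℝ) (hT : 0 ≤ T)
    (u : C(Set.Icc (0 : ℝ) T, Sobolev d 0))
    (z y : C(Set.Icc (0 : ℝ) T, Sobolev d (-β))) : Prop :=
  SatisfiesDuhamel κ T (fun t => (y t).1) (fun t => (z t).1) (fun s =>
    leray (transport (smoothing γ₀ (y (Set.projIcc 0 T hT s)).1) (u (Set.projIcc 0 T hT s)).1
      + transport (smoothing γ₀ (u (Set.projIcc 0 T hT s)).1) (y (Set.projIcc 0 T hT s)).1))

end LerayAlpha

end

open LerayAlpha

noncomputable section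

namespace LerayAlpha

variable {d : ℕ}

/-! ### Inequalities for sums and integrals in `[0, ∞]` -/

/-! The equation is a linear Volterra equation `y = A y + z`, where `A y` is minus the Duhamel
integral of `Π[K(y)·∇ũ + K(ũ)·∇y]`. In the equivalent norm `sup_t e^{-lt}‖y_t‖`, with `‖·‖` the
`H^{-β}` norm, `A` has norm at most `C l^{-(1-δ)/2} ‖u₀‖` for some `δ < 1`. It therefore contracts
by `1/2` once `l` is at least of order `‖u₀‖^q`, `q = 2/(1-δ)`. The Neumann series inverts `1 - A`,
and returning to the supremum norm costs one factor `e^{lT}`: this is the asserted bound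
(`exists_solution_operator`, `exists_linearized_solution_operator`).

The norm of `A` comes from two product estimates on Fourier coefficients, both resting on the
weighted convolution bound `exists_tsum_wt_conv_sq_le`, which only needs total weight above `d/2`.
The product `K(y)·∇ũ` is controlled in `H^{-(β+δ-ε)}` by `‖y‖_{H^{-β}} ‖ũ‖_{H^1}`. In `K(ũ)·∇y` the
field `K(ũ)` is divergence free, so the derivative moves outside the product, and the term is
controlled in `H^{-(β+δ-ε)-1}` by `‖ũ‖_{L²} ‖y‖_{H^{-β}}`. Reaching `H^{-β+ε}` by the heat semigroup
costs `τ^{-δ/2}` and `τ^{-(1+δ)/2}` respectively. The first kernel is paired by Cauchy–Schwarz in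
time with `ũ ∈ L²H¹`, the second with `ũ ∈ L^∞L²`; with the weight `e^{-lτ}` both give
`l^{-(1-δ)/2}` (`exists_lintegral_kernel_le`).

Both norms of `ũ` are bounded by a multiple of `‖u₀‖` through the energy inequality
`IsLerayAlphaSolution.energy_le`. It is proved mode by mode and then summed; the nonlinear
contributions cancel because transport by a divergence-free field is skew symmetric. The surplus `ε
> 0` of regularity makes `A y` continuous in time (`continuous_of_sobSq_bounded`). -/

theorem lintegral_mul_sq_le {α : Type*} [MeasurableSpace α] {μ : Measure α} {f g : α → ENNReal}
    (hf : AEMeasurable f μ) (hg : AEMeasurable g μ) :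
    (∫⁻ a, f a * g a ∂μ) ^ 2 ≤ (∫⁻ a, f a ^ 2 ∂μ) * ∫⁻ a, g a ^ 2 ∂μ := by
  have h := ENNReal.lintegral_mul_le_Lp_mul_Lq μ Real.HolderConjugate.two_two hf hg
  have h2 := pow_le_pow_left' h 2
  rw [mul_pow, ← ENNReal.rpow_natCast, ← ENNReal.rpow_natCast, ← ENNReal.rpow_natCast,
    ← ENNReal.rpow_mul, ← ENNReal.rpow_mul] at h2
  norm_num at h2
  exact h2

theorem tsum_mul_sq_le {ι : Type*} (f g : ι → ENNReal) :
    (∑' i, f i * g i) ^ 2 ≤ (∑' i, f i ^ 2) * ∑' i, g i ^ 2 := by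
  let _ : MeasurableSpace ι := ⊤
  have h := lintegral_mul_sq_le (μ := Measure.count) (f := f) (g := g)
    measurable_from_top.aemeasurable measurable_from_top.aemeasurable
  simpa only [lintegral_count] using h

theorem le_of_sq_le_sq {a b : ENNReal} (h : a ^ 2 ≤ b ^ 2) : a ≤ b := by
  rw [← ENNReal.rpow_natCast, ← ENNReal.rpow_natCast] at h
  exact (ENNReal.rpow_le_rpow_iff (by norm_num)).1 h

theorem add_sq_le (a b : ENNReal) : (a + b) ^ 2 ≤ 2 * (a ^ 2 + b ^ 2) := by
  have h := ENNReal.rpow_add_le_mul_rpow_add_rpow a b (p := 2) (by norm_num)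
  norm_num at h
  exact_mod_cast h

section Convolution

variable {G : Type*} [AddCommGroup G]

/-- The convolution of two sequences with values in `[0, ∞]`. -/
def conv (x y : G → ENNReal) (k : G) : ENNReal := ∑' j, x j * y (k - j)

theorem tsum_sub_left (y : G → ENNReal) (k : G) : ∑' j, y (k - j) = ∑' j, y j :=
  (Equiv.subLeft k).tsum_eq y

theorem tsum_sub_right (y : G → ENNReal) (j : G) : ∑' k, y (k - j) = ∑' k, y k :=
  (Equiv.subRight j).tsum_eq y

theorem conv_sq_le (x y : G → ENNReal) (k : G) :
    conv x y k ^ 2 ≤ (∑' j, x j ^ 2) * ∑' j, y j ^ 2 := by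
  refine (tsum_mul_sq_le _ _).trans_eq ?_
  rw [tsum_sub_left (fun j => y j ^ 2) k]

/-- Young's inequality `ℓ¹ * ℓ² ⊆ ℓ²`. -/
theorem tsum_conv_sq_le (x y : G → ENNReal) :
    ∑' k, conv x y k ^ 2 ≤ (∑' j, x j) ^ 2 * ∑' j, y j ^ 2 := by
  -- Cauchy–Schwarz with `x j` split into two square roots, so that one factor is the `ℓ¹` norm of
  -- `x`; summing over `k` then uses translation invariance.
  have h (k : G) : conv x y k ^ 2 ≤ (∑' j, x j) * ∑' j, x j * y (k - j) ^ 2 := by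
    have hs (j : G) : x j = (x j ^ (1 / 2 : ℝ)) ^ 2 := by
      rw [← ENNReal.rpow_natCast, ← ENNReal.rpow_mul]; norm_num
    have h1 := tsum_mul_sq_le (fun j => x j ^ (1 / 2 : ℝ))
      (fun j => x j ^ (1 / 2 : ℝ) * y (k - j))
    simp only [← mul_assoc, mul_pow, ← hs] at h1
    simp only [← sq, ← hs] at h1
    exact h1
  calc ∑' k, conv x y k ^ 2 ≤ ∑' k, (∑' j, x j) * ∑' j, x j * y (k - j) ^ 2 :=
        ENNReal.tsum_le_tsum h
    _ = (∑' j, x j) * ∑' j, x j * ∑' k, y (k - j) ^ 2 := by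
        rw [ENNReal.tsum_mul_left, ENNReal.tsum_comm]
        simp only [ENNReal.tsum_mul_left]
    _ = (∑' j, x j) ^ 2 * ∑' j, y j ^ 2 := by
        simp only [tsum_sub_right (fun j => y j ^ 2), ENNReal.tsum_mul_right]
        ring

end Convolution

/-- Minkowski's integral inequality for an `ℓ²`-valued integrand. -/
theorem tsum_lintegral_sq_le {ι α : Type*} [MeasurableSpace α] {μ : Measure α}
    {f : ι → α → ENNReal} {g : α → ENNReal} (hf : ∀ i, AEMeasurable (f i) μ)
    (hfg : ∀ᵐ a ∂μ, ∑' i, f i a ^ 2 ≤ g a ^ 2) :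
    ∑' i, (∫⁻ a, f i a ∂μ) ^ 2 ≤ (∫⁻ a, g a ∂μ) ^ 2 := by
  rcases eq_or_ne (∫⁻ a, g a ∂μ) ⊤ with hg | hg
  · simp [hg]
  have hle (i : ι) : ∫⁻ a, f i a ∂μ ≤ ∫⁻ a, g a ∂μ := by
    refine lintegral_mono_ae ?_
    filter_upwards [hfg] with a ha
    exact le_of_sq_le_sq ((ENNReal.le_tsum i).trans ha)
  rw [ENNReal.tsum_eq_iSup_sum]
  refine iSup_le fun s => ?_
  set A : ι → ENNReal := fun i => ∫⁻ a, f i a ∂μ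
  set N2 : ENNReal := ∑ i ∈ s, A i ^ 2
  have hN : N2 ≠ ⊤ := by
    refine (ENNReal.sum_lt_top.2 fun i _ => ?_).ne
    exact ENNReal.pow_lt_top ((hle i).trans_lt hg.lt_top)
  set N : ENNReal := N2 ^ (1 / 2 : ℝ)
  have hNs : N ^ 2 = N2 := by
    rw [← ENNReal.rpow_natCast, ← ENNReal.rpow_mul]; norm_num
  have hNt : N ≠ ⊤ := by
    intro h; rw [h] at hNs; simp at hNs; exact hN hNs.symm
  -- Duality: the vector of integrals `A` is tested against itself under the integral sign.
  -- Restricting to a finite set `s` keeps `N` finite, so that it can be cancelled afterwards.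
  have key : N ^ 2 ≤ N * ∫⁻ a, g a ∂μ := by
    calc N ^ 2 = ∑ i ∈ s, ∫⁻ a, A i * f i a ∂μ := by
          rw [hNs]
          refine Finset.sum_congr rfl fun i _ => ?_
          rw [lintegral_const_mul'' _ (hf i), sq]
      _ = ∫⁻ a, ∑ i ∈ s, A i * f i a ∂μ :=
          (lintegral_finsetSum' s fun i _ => (hf i).const_mul _).symm
      _ ≤ ∫⁻ a, N * g a ∂μ := by
          refine lintegral_mono_ae ?_
          filter_upwards [hfg] with a ha
          refine le_of_sq_le_sq ?_
          have h1 := tsum_mul_sq_le (fun i : s => A i) (fun i : s => f i a)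
          rw [Finset.tsum_subtype s (fun i => A i * f i a),
            Finset.tsum_subtype s (fun i => A i ^ 2)] at h1
          rw [mul_pow, hNs]
          refine h1.trans (mul_le_mul' le_rfl (le_trans ?_ ha))
          rw [Finset.tsum_subtype s (fun i => f i a ^ 2)]
          exact ENNReal.sum_le_tsum s
      _ = N * ∫⁻ a, g a ∂μ := lintegral_const_mul' _ _ hNt
  rw [← hNs]
  refine pow_le_pow_left' ?_ 2
  rcases eq_or_ne N 0 with h0 | h0
  · simp [h0]
  rw [sq] at key
  exact (ENNReal.mul_le_mul_iff_right h0 hNt).1 key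

/-! ### Frequency weights -/

theorem absFreq_eq_norm (k : Fin d → ℤ) :
    absFreq k = 2 * Real.pi * ‖WithLp.toLp 2 (fun i => (k i : ℝ))‖ := by
  rw [absFreq, EuclideanSpace.norm_eq]; simp

theorem absFreq_nonneg (k : Fin d → ℤ) : 0 ≤ absFreq k := by
  unfold absFreq; positivity

@[simp] theorem absFreq_zero : absFreq (0 : Fin d → ℤ) = 0 := by simp [absFreq]

@[simp] theorem absFreq_neg (k : Fin d → ℤ) : absFreq (-k) = absFreq k := by simp [absFreq]

theorem absFreq_add_le (k j : Fin d → ℤ) : absFreq (k + j) ≤ absFreq k + absFreq j := by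
  simp only [absFreq_eq_norm]
  rw [← mul_add]
  refine mul_le_mul_of_nonneg_left ?_ (by positivity)
  have h : WithLp.toLp 2 (fun i => ((k + j) i : ℝ)) =
      WithLp.toLp 2 (fun i => (k i : ℝ)) + WithLp.toLp 2 (fun i => (j i : ℝ)) := by
    ext i; simp
  rw [h]
  exact norm_add_le _ _

theorem absFreq_sub_le (k j : Fin d → ℤ) : absFreq (k - j) ≤ absFreq k + absFreq j := by
  rw [sub_eq_add_neg, ← absFreq_neg j]; exact absFreq_add_le _ _

theorem one_le_absFreq {k : Fin d → ℤ} (hk : k ≠ 0) : 1 ≤ absFreq k := by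
  have h : ∃ i, k i ≠ 0 := by
    by_contra h
    push Not at h
    exact hk (funext h)
  obtain ⟨i, hi⟩ := h
  have h1 : (1 : ℝ) ≤ ∑ i, (k i : ℝ) ^ 2 := by
    have h2 : (1 : ℝ) ≤ (k i : ℝ) ^ 2 := by
      have : 1 ≤ (k i) ^ 2 := by have := sq_pos_iff.2 hi; lia
      exact_mod_cast this
    exact h2.trans (Finset.single_le_sum (f := fun i => (k i : ℝ) ^ 2)
      (fun j _ => sq_nonneg _) (Finset.mem_univ i))
  unfold absFreq
  have h3 : 1 ≤ Real.sqrt (∑ i, (k i : ℝ) ^ 2) := by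
    rw [← Real.sqrt_one]; exact Real.sqrt_le_sqrt h1
  nlinarith [Real.pi_gt_three]

theorem absFreq_pos_of_ne {k : Fin d → ℤ} (hk : k ≠ 0) : 0 < absFreq k :=
  one_pos.trans_le (one_le_absFreq hk)

theorem absFreq_rpow_sub_le {β : ℝ} (hβ : 0 ≤ β) (k j : Fin d → ℤ) :
    absFreq (k - j) ^ β ≤ 2 ^ β * (absFreq k ^ β + absFreq j ^ β) := by
  have h1 : absFreq (k - j) ≤ 2 * max (absFreq k) (absFreq j) := by
    have := absFreq_sub_le k j
    linarith [le_max_left (absFreq k) (absFreq j), le_max_right (absFreq k) (absFreq j)]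
  have hm : 0 ≤ max (absFreq k) (absFreq j) := le_max_of_le_left (absFreq_nonneg k)
  calc absFreq (k - j) ^ β ≤ (2 * max (absFreq k) (absFreq j)) ^ β :=
        Real.rpow_le_rpow (absFreq_nonneg _) h1 hβ
    _ = 2 ^ β * max (absFreq k) (absFreq j) ^ β := Real.mul_rpow (by norm_num) hm
    _ ≤ _ := by
        refine mul_le_mul_of_nonneg_left ?_ (by positivity)
        have ha := Real.rpow_nonneg (absFreq_nonneg k) β
        have hb := Real.rpow_nonneg (absFreq_nonneg j) β
        rcases max_choice (absFreq k) (absFreq j) with h | h <;> rw [h] <;> linarith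

/-- The integer points form a lattice of rank `d` in Euclidean space, so the general summability
criterion for powers of the norm over a lattice applies. -/
theorem summable_absFreq_rpow {r : ℝ} (hr : r < -(d : ℝ)) :
    Summable fun k : Fin d → ℤ => absFreq k ^ r := by
  let b := (EuclideanSpace.basisFun (Fin d) ℝ).toBasis
  let L : Submodule ℤ (EuclideanSpace ℝ (Fin d)) := Submodule.span ℤ (Set.range b)
  have hfin : (Module.finrank ℤ L : ℝ) = d := by
    rw [ZLattice.rank ℝ L]; simp
  have h := ZLattice.summable_norm_rpow L r (by rw [hfin]; exact hr)
  have hmem (k : Fin d → ℤ) : WithLp.toLp 2 (fun i => (k i : ℝ)) ∈ L := by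
    have h2 : WithLp.toLp 2 (fun i => (k i : ℝ)) = ∑ i, k i • b i := by
      ext j
      simp [b, Pi.single_apply]
    rw [h2]
    exact Submodule.sum_mem _ fun i _ => Submodule.smul_mem _ _ (Submodule.subset_span ⟨i, rfl⟩)
  let f : (Fin d → ℤ) → L := fun k => ⟨_, hmem k⟩
  have hf : Function.Injective f := by
    intro k j hkj
    funext i
    have h3 : WithLp.toLp 2 (fun i => (k i : ℝ)) = WithLp.toLp 2 (fun i => (j i : ℝ)) :=
      congrArg Subtype.val hkj
    have h4 := congrArg (fun v : EuclideanSpace ℝ (Fin d) => v i) h3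
    simpa using h4
  have h5 := (h.comp_injective hf).mul_left ((2 * Real.pi) ^ r)
  refine h5.congr fun k => ?_
  rw [absFreq_eq_norm, Real.mul_rpow (by positivity) (norm_nonneg _)]
  rfl

/-- The weight `|2πk|^p`, set to `0` at `k = 0`. -/
def wt (p : ℝ) (k : Fin d → ℤ) : ENNReal := if k = 0 then 0 else ENNReal.ofReal (absFreq k ^ p)

@[simp] theorem wt_zero (p : ℝ) : wt p (0 : Fin d → ℤ) = 0 := by simp [wt]

theorem wt_of_ne (p : ℝ) {k : Fin d → ℤ} (hk : k ≠ 0) :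
    wt p k = ENNReal.ofReal (absFreq k ^ p) := by simp [wt, hk]

theorem wt_ne_top (p : ℝ) (k : Fin d → ℤ) : wt p k ≠ ⊤ := by
  unfold wt; split <;> simp

theorem wt_ne_zero (p : ℝ) {k : Fin d → ℤ} (hk : k ≠ 0) : wt p k ≠ 0 := by
  rw [wt_of_ne p hk]
  exact (ENNReal.ofReal_pos.2 (Real.rpow_pos_of_pos (absFreq_pos_of_ne hk) p)).ne'

theorem wt_mul (p q : ℝ) (k : Fin d → ℤ) : wt p k * wt q k = wt (p + q) k := by
  rcases eq_or_ne k 0 with rfl | hk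
  · simp
  rw [wt_of_ne _ hk, wt_of_ne _ hk, wt_of_ne _ hk, ← ENNReal.ofReal_mul
    (Real.rpow_nonneg (absFreq_nonneg k) _), Real.rpow_add (absFreq_pos_of_ne hk)]

theorem wt_pow_two (p : ℝ) (k : Fin d → ℤ) : wt p k ^ 2 = wt (2 * p) k := by
  rw [sq, wt_mul, two_mul]

theorem wt_mono {p q : ℝ} (h : p ≤ q) (k : Fin d → ℤ) : wt p k ≤ wt q k := by
  rcases eq_or_ne k 0 with rfl | hk
  · simp
  rw [wt_of_ne _ hk, wt_of_ne _ hk]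
  exact ENNReal.ofReal_le_ofReal (Real.rpow_le_rpow_of_exponent_le (one_le_absFreq hk) h)

theorem wt_exponent_zero {k : Fin d → ℤ} (hk : k ≠ 0) : wt 0 k = 1 := by
  rw [wt_of_ne _ hk]; simp

theorem wt_exponent_zero_le (k : Fin d → ℤ) : wt 0 k ≤ 1 := by
  rcases eq_or_ne k 0 with rfl | hk
  · simp
  · rw [wt_exponent_zero hk]

theorem wt_sub_le {β : ℝ} (hβ : 0 ≤ β) {k j : Fin d → ℤ} (hk : k ≠ 0) (hj : j ≠ 0) :
    wt β (k - j) ≤ ENNReal.ofReal (2 ^ β) * (wt β k + wt β j) := by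
  rcases eq_or_ne (k - j) 0 with h | h
  · rw [h]; simp
  rw [wt_of_ne _ h, wt_of_ne _ hk, wt_of_ne _ hj, ← ENNReal.ofReal_add
    (Real.rpow_nonneg (absFreq_nonneg k) _) (Real.rpow_nonneg (absFreq_nonneg j) _),
    ← ENNReal.ofReal_mul (by positivity)]
  exact ENNReal.ofReal_le_ofReal (absFreq_rpow_sub_le hβ k j)

theorem tsum_wt_lt_top {r : ℝ} (hr : r < -(d : ℝ)) : ∑' k : Fin d → ℤ, wt r k < ⊤ := by
  refine lt_of_le_of_lt (ENNReal.tsum_le_tsum (g := fun k => ENNReal.ofReal (absFreq k ^ r))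
    fun k => ?_) (summable_absFreq_rpow hr).tsum_ofReal_lt_top
  unfold wt; split <;> simp

/-- Whichever of the two frequencies is shorter can absorb both negative exponents. The factors of
exponent `0` only record that the other frequency is nonzero. -/
theorem wt_mul_wt_le {a b : ℝ} (ha : 0 ≤ a) (hb : 0 ≤ b) (k j : Fin d → ℤ) :
    wt (-a) k * wt (-b) j ≤ wt (-(a + b)) k * wt 0 j + wt (-(a + b)) j * wt 0 k := by
  rcases eq_or_ne k 0 with rfl | hk
  · simp
  rcases eq_or_ne j 0 with rfl | hj
  · simp
  rw [wt_exponent_zero hk, wt_exponent_zero hj, mul_one, mul_one]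
  have hanti {p : ℝ} (hp : 0 ≤ p) {x y : Fin d → ℤ} (hx : x ≠ 0) (hy : y ≠ 0)
      (hxy : absFreq x ≤ absFreq y) : wt (-p) y ≤ wt (-p) x := by
    rw [wt_of_ne _ hx, wt_of_ne _ hy]
    exact ENNReal.ofReal_le_ofReal
      (Real.rpow_le_rpow_of_nonpos (absFreq_pos_of_ne hx) hxy (by linarith))
  rw [neg_add, ← wt_mul, ← wt_mul]
  rcases le_total (absFreq k) (absFreq j) with h | h
  · exact (mul_le_mul' le_rfl (hanti hb hk hj h)).trans le_self_add
  · exact (mul_le_mul' (hanti ha hj hk h) le_rfl).trans le_add_self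

/-- A convolution estimate in weighted `ℓ²` spaces: the total weight only has to exceed `d/2`. -/
theorem exists_tsum_wt_conv_sq_le {a b : ℝ} (ha : 0 ≤ a) (hb : 0 ≤ b) (hab : (d : ℝ) / 2 < a + b) :
    ∃ C : ENNReal, C ≠ ⊤ ∧ ∀ x y : (Fin d → ℤ) → ENNReal,
      ∑' k, (wt (-a) k * conv (fun j => wt (-b) j * x j) y k) ^ 2
        ≤ C * ((∑' j, x j ^ 2) * ∑' j, y j ^ 2) := by
  set W : ENNReal := ∑' k : Fin d → ℤ, wt (2 * -(a + b)) k
  have hW : W ≠ ⊤ := (tsum_wt_lt_top (by linarith)).ne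
  refine ⟨2 * (W + W), ENNReal.mul_ne_top (by simp) (ENNReal.add_ne_top.2 ⟨hW, hW⟩), fun x y => ?_⟩
  set X := ∑' j, x j ^ 2
  set Y := ∑' j, y j ^ 2
  have h1 (k : Fin d → ℤ) : wt (-a) k * conv (fun j => wt (-b) j * x j) y k ≤
      wt (-(a + b)) k * conv x y k + conv (fun j => wt (-(a + b)) j * x j) y k := by
    simp only [conv]
    rw [← ENNReal.tsum_mul_left, ← ENNReal.tsum_mul_left, ← ENNReal.tsum_add]
    refine ENNReal.tsum_le_tsum fun j => ?_
    calc wt (-a) k * (wt (-b) j * x j * y (k - j)) = wt (-a) k * wt (-b) j * (x j * y (k - j)) := by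
          ring
      _ ≤ (wt (-(a + b)) k * wt 0 j + wt (-(a + b)) j * wt 0 k) * (x j * y (k - j)) :=
          mul_le_mul' (wt_mul_wt_le ha hb k j) le_rfl
      _ ≤ (wt (-(a + b)) k * 1 + wt (-(a + b)) j * 1) * (x j * y (k - j)) := by
          gcongr <;> exact wt_exponent_zero_le _
      _ = _ := by ring
  calc ∑' k, (wt (-a) k * conv (fun j => wt (-b) j * x j) y k) ^ 2
      ≤ ∑' k, 2 * ((wt (-(a + b)) k * conv x y k) ^ 2
          + conv (fun j => wt (-(a + b)) j * x j) y k ^ 2) :=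
        ENNReal.tsum_le_tsum fun k => (pow_le_pow_left' (h1 k) 2).trans (add_sq_le _ _)
    _ = 2 * (∑' k, (wt (-(a + b)) k * conv x y k) ^ 2
          + ∑' k, conv (fun j => wt (-(a + b)) j * x j) y k ^ 2) := by
        rw [ENNReal.tsum_mul_left, ENNReal.tsum_add]
    -- With weight `-(a+b)` outside, the convolution is bounded pointwise and the weight is square
    -- summable. With the weight on `x`, Cauchy–Schwarz makes the weighted sequence summable and
    -- Young's inequality applies.
    _ ≤ 2 * (W * (X * Y) + W * X * Y) := by
        gcongr
        · rw [← ENNReal.tsum_mul_right]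
          refine ENNReal.tsum_le_tsum fun k => ?_
          rw [mul_pow, wt_pow_two]
          exact mul_le_mul' le_rfl (conv_sq_le x y k)
        · refine (tsum_conv_sq_le _ _).trans (mul_le_mul' ?_ le_rfl)
          refine (tsum_mul_sq_le _ _).trans ?_
          simp only [wt_pow_two]
          exact le_rfl
    _ = 2 * (W + W) * (X * Y) := by ring

/-! ### Sobolev norms of formal series -/

@[simp] theorem coeff_freq_zero (u : FourierSeries d) : coeff u 0 = 0 := by simp [coeff]

theorem coeff_of_ne (u : FourierSeries d) {k : Fin d → ℤ} (hk : k ≠ 0) :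
    coeff u k = u ⟨k, hk⟩ := by simp [coeff, hk]

@[simp] theorem coeff_coe (u : FourierSeries d) (k : Freq d) : coeff u k.1 = u k :=
  coeff_of_ne u k.2

theorem coeff_add (u v : FourierSeries d) (k : Fin d → ℤ) :
    coeff (u + v) k = coeff u k + coeff v k := by
  rcases eq_or_ne k 0 with rfl | hk
  · simp
  · simp only [coeff_of_ne _ hk]; rfl

theorem coeff_smul (c : ℝ) (u : FourierSeries d) (k : Fin d → ℤ) :
    coeff (c • u) k = c • coeff u k := by
  rcases eq_or_ne k 0 with rfl | hk
  · simp
  · simp only [coeff_of_ne _ hk]; rfl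

theorem coeff_sub (u v : FourierSeries d) (k : Fin d → ℤ) :
    coeff (u - v) k = coeff u k - coeff v k := by
  rcases eq_or_ne k 0 with rfl | hk
  · simp
  · simp only [coeff_of_ne _ hk]; rfl

theorem tsum_freq {f : (Fin d → ℤ) → ENNReal} (h : f 0 = 0) :
    ∑' k : Freq d, f k.1 = ∑' k, f k := by
  refine tsum_subtype_eq_of_support_subset (s := {k : Fin d → ℤ | k ≠ 0}) fun k hk => ?_
  rintro rfl
  exact hk h

/-- `‖u‖²_{H^s} ∈ [0, ∞]` for an arbitrary formal series. -/
def sobSq (s : ℝ) (u : FourierSeries d) : ENNReal :=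
  ∑' k : Fin d → ℤ, (wt s k * ‖coeff u k‖ₑ) ^ 2

theorem sobSq_eq_freq (s : ℝ) (u : FourierSeries d) :
    sobSq s u = ∑' k : Freq d, (wt s k.1 * ‖u k‖ₑ) ^ 2 := by
  rw [sobSq, ← tsum_freq (by simp)]
  simp

theorem wt_mul_enorm_sq (s : ℝ) (u : FourierSeries d) (k : Freq d) :
    (wt s k.1 * ‖u k‖ₑ) ^ 2 = ENNReal.ofReal (absFreq k.1 ^ (2 * s) * ‖u k‖ ^ 2) := by
  rw [mul_pow, wt_pow_two, wt_of_ne _ k.2, ENNReal.ofReal_mul (Real.rpow_nonneg (absFreq_nonneg _) _),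
    ENNReal.ofReal_pow (norm_nonneg _), ofReal_norm]

theorem sobolevOneSq_eq (u : FourierSeries d) : sobolevOneSq u = sobSq 1 u := by
  rw [sobSq_eq_freq, sobolevOneSq]
  refine tsum_congr fun k => ?_
  rw [wt_mul_enorm_sq]; norm_num

theorem sobSq_mono {s r : ℝ} (h : s ≤ r) (u : FourierSeries d) : sobSq s u ≤ sobSq r u :=
  ENNReal.tsum_le_tsum fun k => pow_le_pow_left' (mul_le_mul' (wt_mono h k) le_rfl) 2

theorem memℓp_weighted_iff {s : ℝ} {u : FourierSeries d} :
    Memℓp (weighted s u) 2 ↔ sobSq s u < ⊤ := by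
  rw [memℓp_gen_iff (by norm_num), sobSq_eq_freq]
  have h (k : Freq d) : ‖weighted s u k‖ ^ (2 : ENNReal).toReal =
      absFreq k.1 ^ (2 * s) * ‖u k‖ ^ 2 := by
    rw [weighted, norm_smul, Real.norm_of_nonneg (Real.rpow_nonneg (absFreq_nonneg _) _)]
    norm_num
    rw [mul_pow, mul_comm 2 s, Real.rpow_mul (absFreq_nonneg _)]
    norm_num
  simp only [h, wt_mul_enorm_sq]
  have hn (k : Freq d) : 0 ≤ absFreq k.1 ^ (2 * s) * ‖u k‖ ^ 2 :=
    mul_nonneg (Real.rpow_nonneg (absFreq_nonneg _) _) (sq_nonneg _)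
  refine ⟨fun hs => hs.tsum_ofReal_lt_top, fun hs => ?_⟩
  have := ENNReal.summable_toReal hs.ne
  exact this.congr fun k => ENNReal.toReal_ofReal (hn k)

theorem Sobolev.mk_mem {s : ℝ} {u : FourierSeries d} (h : sobSq s u < ⊤) (hr : IsReal u) :
    u ∈ Sobolev d s := ⟨memℓp_weighted_iff.2 h, hr⟩

theorem Sobolev.sobSq_lt_top {s : ℝ} (u : Sobolev d s) : sobSq s u.1 < ⊤ :=
  memℓp_weighted_iff.1 u.2.1

theorem Sobolev.enorm_sq_eq {s : ℝ} (u : Sobolev d s) : ‖u‖ₑ ^ 2 = sobSq s u.1 := by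
  have hn (k : Freq d) : 0 ≤ absFreq k.1 ^ (2 * s) * ‖u.1 k‖ ^ 2 :=
    mul_nonneg (Real.rpow_nonneg (absFreq_nonneg _) _) (sq_nonneg _)
  rw [← ofReal_norm, ← ENNReal.ofReal_pow (norm_nonneg _), Sobolev.norm_sq_eq, sobSq_eq_freq]
  simp only [wt_mul_enorm_sq]
  refine ENNReal.ofReal_tsum_of_nonneg hn ?_
  have h := Sobolev.sobSq_lt_top u
  rw [sobSq_eq_freq] at h
  simp only [wt_mul_enorm_sq] at h
  exact (ENNReal.summable_toReal h.ne).congr fun k => ENNReal.toReal_ofReal (hn k)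

/-! ### Bounds for the transport term -/

/-- The summands of the `k`-th coefficient of `V · ∇f`. -/
def transportTerm (V f : FourierSeries d) (k j : Fin d → ℤ) : EuclideanSpace ℂ (Fin d) :=
  (2 * Real.pi * Complex.I * ∑ l, coeff V j l * ((k - j) l : ℂ)) • coeff f (k - j)

theorem transport_apply (V f : FourierSeries d) (k : Freq d) :
    transport V f k = ∑' j, transportTerm V f k.1 j := rfl

/-- The sum of the norms of the summands of `(V · ∇f)^_k`. -/
def absTransport (V f : FourierSeries d) (k : Fin d → ℤ) : ENNReal :=
  ∑' j, ‖transportTerm V f k j‖ₑ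

theorem norm_two_pi_mul_sum_le (v : EuclideanSpace ℂ (Fin d)) (m : Fin d → ℤ) :
    ‖2 * Real.pi * Complex.I * ∑ l, v l * (m l : ℂ)‖ ≤ ‖v‖ * absFreq m := by
  have h : ∑ l, v l * (m l : ℂ) = inner ℂ (WithLp.toLp 2 (fun i => (m i : ℂ))) v := by
    simp [PiLp.inner_apply]
  have h2 : ‖(WithLp.toLp 2 (fun i => (m i : ℂ)) : EuclideanSpace ℂ (Fin d))‖ =
      Real.sqrt (∑ i, (m i : ℝ) ^ 2) := by
    rw [EuclideanSpace.norm_eq]; simp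
  rw [h, norm_mul, absFreq, ← h2]
  have h3 : ‖(2 * Real.pi * Complex.I : ℂ)‖ = 2 * Real.pi := by
    simp [abs_of_pos Real.pi_pos]
  rw [h3]
  have := norm_inner_le_norm (𝕜 := ℂ) (WithLp.toLp 2 (fun i => (m i : ℂ))) v
  nlinarith [Real.pi_pos]

theorem enorm_two_pi_mul_sum_le (v : EuclideanSpace ℂ (Fin d)) {m : Fin d → ℤ} (hm : m ≠ 0) :
    ‖2 * Real.pi * Complex.I * ∑ l, v l * (m l : ℂ)‖ₑ ≤ ‖v‖ₑ * wt 1 m := by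
  rw [wt_of_ne _ hm, Real.rpow_one, ← ofReal_norm, ← ofReal_norm,
    ← ENNReal.ofReal_mul (norm_nonneg _)]
  exact ENNReal.ofReal_le_ofReal (norm_two_pi_mul_sum_le v m)

theorem enorm_transportTerm_le (V f : FourierSeries d) (k j : Fin d → ℤ) :
    ‖transportTerm V f k j‖ₑ ≤ ‖coeff V j‖ₑ * (wt 1 (k - j) * ‖coeff f (k - j)‖ₑ) := by
  rcases eq_or_ne (k - j) 0 with h | h
  · simp [transportTerm, h]
  · rw [transportTerm, enorm_smul, ← mul_assoc]
    exact mul_le_mul' (enorm_two_pi_mul_sum_le _ h) le_rfl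

theorem IsDivFree.sum_coeff {V : FourierSeries d} (hV : IsDivFree V) (j : Fin d → ℤ) :
    ∑ l, coeff V j l * (j l : ℂ) = 0 := by
  rcases eq_or_ne j 0 with rfl | hj
  · simp
  · rw [coeff_of_ne _ hj]
    simpa only [mul_comm] using hV ⟨j, hj⟩

/-- Since `j · V̂_j = 0`, the factor `V̂_j · (k - j)` equals `V̂_j · k`: this is `V·∇f = div(V ⊗ f)`
in Fourier variables. The derivative no longer falls on `f`, which may then be a distribution. -/
theorem transportTerm_of_isDivFree {V : FourierSeries d} (hV : IsDivFree V) (f : FourierSeries d)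
    (k j : Fin d → ℤ) : transportTerm V f k j =
      (2 * Real.pi * Complex.I * ∑ l, coeff V j l * (k l : ℂ)) • coeff f (k - j) := by
  rw [transportTerm]
  congr 2
  simp only [Pi.sub_apply, Int.cast_sub, mul_sub, Finset.sum_sub_distrib, hV.sum_coeff j, sub_zero]

theorem enorm_transportTerm_le_of_isDivFree {V : FourierSeries d} (hV : IsDivFree V)
    (f : FourierSeries d) {k : Fin d → ℤ} (hk : k ≠ 0) (j : Fin d → ℤ) :
    ‖transportTerm V f k j‖ₑ ≤ wt 1 k * (‖coeff V j‖ₑ * ‖coeff f (k - j)‖ₑ) := by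
  rw [transportTerm_of_isDivFree hV, enorm_smul, ← mul_assoc, mul_comm (wt 1 k)]
  exact mul_le_mul' (enorm_two_pi_mul_sum_le _ hk) le_rfl

theorem isDivFree_smoothing {γ₀ : ℝ} {u : FourierSeries d} (hu : IsDivFree u) :
    IsDivFree (smoothing γ₀ u) := by
  intro k
  have h := congrArg (fun z : ℂ => ((1 / (1 + absFreq k.1 ^ (2 * γ₀)) : ℝ) : ℂ) * z) (hu k)
  simp only [mul_zero, Finset.mul_sum] at h
  rw [← h]
  refine Finset.sum_congr rfl fun i _ => ?_
  simp only [smoothing, PiLp.smul_apply, Complex.real_smul]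
  ring

theorem enorm_coeff_smoothing_le (γ₀ : ℝ) (u : FourierSeries d) (j : Fin d → ℤ) :
    ‖coeff (smoothing γ₀ u) j‖ₑ ≤ wt (-(2 * γ₀)) j * ‖coeff u j‖ₑ := by
  rcases eq_or_ne j 0 with rfl | hj
  · simp
  rw [coeff_of_ne _ hj, coeff_of_ne _ hj, smoothing, enorm_smul, wt_of_ne _ hj]
  gcongr
  have hp := Real.rpow_pos_of_pos (absFreq_pos_of_ne hj) (2 * γ₀)
  rw [← ofReal_norm, Real.norm_of_nonneg (by positivity), Real.rpow_neg (absFreq_nonneg _)]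
  refine ENNReal.ofReal_le_ofReal ?_
  rw [one_div]
  exact inv_anti₀ hp (by linarith)

theorem wt_neg_mul_wt {k : Fin d → ℤ} (hk : k ≠ 0) (s : ℝ) : wt s k * wt (-s) k = 1 := by
  rw [wt_mul, add_neg_cancel, wt_exponent_zero hk]

theorem enorm_coeff_eq (s : ℝ) (u : FourierSeries d) (k : Fin d → ℤ) :
    ‖coeff u k‖ₑ = wt (-s) k * (wt s k * ‖coeff u k‖ₑ) := by
  rcases eq_or_ne k 0 with rfl | hk
  · simp
  · rw [← mul_assoc, mul_comm (wt (-s) k), wt_neg_mul_wt hk, one_mul]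

/-- The transport of `f ∈ H¹` by `K(v)`, `v ∈ H^s`. -/
theorem exists_absTransport_smoothing_le {γ₀ s a : ℝ} (ha : 0 ≤ a) (hs : 0 ≤ 2 * γ₀ + s)
    (has : (d : ℝ) / 2 < a + (2 * γ₀ + s)) :
    ∃ C : ENNReal, C ≠ ⊤ ∧ ∀ v f : FourierSeries d,
      ∑' k, (wt (-a) k * absTransport (smoothing γ₀ v) f k) ^ 2 ≤ C * (sobSq s v * sobSq 1 f) := by
  obtain ⟨C, hC, h⟩ := exists_tsum_wt_conv_sq_le ha hs has
  refine ⟨C, hC, fun v f => le_trans (ENNReal.tsum_le_tsum fun k => pow_le_pow_left'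
    (mul_le_mul' le_rfl (ENNReal.tsum_le_tsum fun j => ?_)) 2)
    (h (fun j => wt s j * ‖coeff v j‖ₑ) (fun j => wt 1 j * ‖coeff f j‖ₑ))⟩
  refine (enorm_transportTerm_le _ _ _ _).trans (mul_le_mul' ?_ le_rfl)
  refine (enorm_coeff_smoothing_le _ _ _).trans_eq ?_
  rw [enorm_coeff_eq s, ← mul_assoc, wt_mul]
  congr 2
  ring

/-- The transport of `f ∈ H^{-β}` by `K(u)`, `u ∈ L²` divergence free. -/
theorem exists_absTransport_smoothing_le_of_isDivFree {γ₀ β r : ℝ} (hβ : 0 ≤ β) (hβγ : β ≤ 2 * γ₀)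
    (hr : β ≤ r) (hd : (d : ℝ) / 2 < r - β + 2 * γ₀) :
    ∃ C : ENNReal, C ≠ ⊤ ∧ ∀ u f : FourierSeries d, IsDivFree u →
      ∑' k, (wt (-(r + 1)) k * absTransport (smoothing γ₀ u) f k) ^ 2
        ≤ C * (sobSq 0 u * sobSq (-β) f) := by
  -- The weight `|k-j|^β` needed to measure `f` in `H^{-β}` is split between `k` and `j`. It lowers
  -- the output weight to `r - β` in one case and the smoothing weight to `2γ₀ - β` in the other;
  -- the total is the same.
  obtain ⟨C₁, hC₁, h₁⟩ := exists_tsum_wt_conv_sq_le (d := d) (a := r - β) (b := 2 * γ₀)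
    (by linarith) (by linarith) hd
  obtain ⟨C₂, hC₂, h₂⟩ := exists_tsum_wt_conv_sq_le (d := d) (a := r) (b := 2 * γ₀ - β)
    (by linarith) (by linarith) (by linarith)
  set B : ENNReal := ENNReal.ofReal (2 ^ β)
  refine ⟨B ^ 2 * (2 * (C₁ + C₂)), ENNReal.mul_ne_top (by simp [B])
    (ENNReal.mul_ne_top (by simp) (ENNReal.add_ne_top.2 ⟨hC₁, hC₂⟩)), fun u f hu => ?_⟩
  set x : (Fin d → ℤ) → ENNReal := fun j => wt 0 j * ‖coeff u j‖ₑ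
  set η : (Fin d → ℤ) → ENNReal := fun j => wt (-β) j * ‖coeff f j‖ₑ
  have hx : ∑' j, x j ^ 2 = sobSq 0 u := rfl
  have hη : ∑' j, η j ^ 2 = sobSq (-β) f := rfl
  rw [← hx, ← hη]
  have hk (k : Fin d → ℤ) : wt (-(r + 1)) k * absTransport (smoothing γ₀ u) f k ≤
      B * (wt (-(r - β)) k * conv (fun j => wt (-(2 * γ₀)) j * x j) η k
        + wt (-r) k * conv (fun j => wt (-(2 * γ₀ - β)) j * x j) η k) := by
    rcases eq_or_ne k 0 with rfl | hk
    · simp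
    have hterm (j : Fin d → ℤ) : ‖transportTerm (smoothing γ₀ u) f k j‖ₑ ≤
        wt 1 k * (B * (wt β k * (wt (-(2 * γ₀)) j * x j * η (k - j))
          + wt (-(2 * γ₀ - β)) j * x j * η (k - j))) := by
      refine (enorm_transportTerm_le_of_isDivFree (isDivFree_smoothing hu) f hk j).trans
        (mul_le_mul' le_rfl ?_)
      rcases eq_or_ne j 0 with rfl | hj
      · simp
      refine (mul_le_mul' (enorm_coeff_smoothing_le _ _ _) (enorm_coeff_eq (-β) f _).le).trans ?_
      rw [neg_neg]
      have hx' : ‖coeff u j‖ₑ = x j := by simp [x, wt_exponent_zero hj]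
      rw [hx']
      refine (mul_le_mul' le_rfl (mul_le_mul' (wt_sub_le hβ hk hj) le_rfl)).trans_eq ?_
      have h3 : wt (-(2 * γ₀ - β)) j = wt (-(2 * γ₀)) j * wt β j := by
        rw [wt_mul]; congr 1; ring
      rw [h3]
      ring
    calc wt (-(r + 1)) k * absTransport (smoothing γ₀ u) f k
        ≤ wt (-(r + 1)) k * ∑' j, wt 1 k * (B * (wt β k * (wt (-(2 * γ₀)) j * x j * η (k - j))
          + wt (-(2 * γ₀ - β)) j * x j * η (k - j))) :=
          mul_le_mul' le_rfl (ENNReal.tsum_le_tsum hterm)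
      _ = (wt (-(r + 1)) k * wt 1 k) * (B * (wt β k * conv (fun j => wt (-(2 * γ₀)) j * x j) η k
          + conv (fun j => wt (-(2 * γ₀ - β)) j * x j) η k)) := by
          rw [ENNReal.tsum_mul_left, ENNReal.tsum_mul_left, ENNReal.tsum_add, ENNReal.tsum_mul_left]
          simp only [conv, mul_assoc]
      _ = _ := by
          rw [wt_mul, show -(r + 1) + 1 = -r by ring, show -(r - β) = -r + β by ring, ← wt_mul (-r) β]
          ring
  calc _ ≤ ∑' k, B ^ 2 * (2 * ((wt (-(r - β)) k * conv (fun j => wt (-(2 * γ₀)) j * x j) η k) ^ 2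
        + (wt (-r) k * conv (fun j => wt (-(2 * γ₀ - β)) j * x j) η k) ^ 2)) :=
        ENNReal.tsum_le_tsum fun k => by
          refine (pow_le_pow_left' (hk k) 2).trans ?_
          rw [mul_pow]
          exact mul_le_mul' le_rfl (add_sq_le _ _)
    _ = B ^ 2 * (2 * (∑' k, (wt (-(r - β)) k * conv (fun j => wt (-(2 * γ₀)) j * x j) η k) ^ 2
        + ∑' k, (wt (-r) k * conv (fun j => wt (-(2 * γ₀ - β)) j * x j) η k) ^ 2)) := by
        rw [ENNReal.tsum_mul_left, ENNReal.tsum_mul_left, ENNReal.tsum_add]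
    _ ≤ B ^ 2 * (2 * (C₁ * ((∑' j, x j ^ 2) * ∑' j, η j ^ 2)
        + C₂ * ((∑' j, x j ^ 2) * ∑' j, η j ^ 2))) := by
        gcongr
        · exact h₁ x η
        · exact h₂ x η
    _ = _ := by ring

theorem absTransport_ne_top_of_tsum {V f : FourierSeries d} {p : ℝ}
    (h : ∑' k, (wt p k * absTransport V f k) ^ 2 ≠ ⊤) (k : Freq d) : absTransport V f k.1 ≠ ⊤ := by
  intro htop
  refine h (ENNReal.tsum_eq_top_of_eq_top ⟨k.1, ?_⟩)
  rw [htop, ENNReal.mul_top (wt_ne_zero p k.2)]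
  rfl

/-! ### Real fields -/

/-- Componentwise complex conjugation. -/
def conjVec (d : ℕ) : EuclideanSpace ℂ (Fin d) ≃ₗᵢ[ℝ] EuclideanSpace ℂ (Fin d) :=
  LinearIsometryEquiv.piLpCongrRight 2 fun _ => Complex.conjLIE

@[simp] theorem conjVec_apply (v : EuclideanSpace ℂ (Fin d)) (i : Fin d) :
    conjVec d v i = star (v i) := rfl

theorem conjVec_smul (c : ℂ) (v : EuclideanSpace ℂ (Fin d)) :
    conjVec d (c • v) = star c • conjVec d v := by
  ext i; simp

theorem isReal_iff {u : FourierSeries d} :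
    IsReal u ↔ ∀ k : Fin d → ℤ, coeff u (-k) = conjVec d (coeff u k) :=
  ⟨fun h k => by ext i; exact h k i, fun h k i => by rw [h k]; rfl⟩

theorem isReal_iff_freq {u : FourierSeries d} :
    IsReal u ↔ ∀ k : Freq d, u ⟨-k.1, neg_ne_zero.2 k.2⟩ = conjVec d (u k) := by
  rw [isReal_iff]
  constructor
  · intro h k
    have := h k.1
    rwa [coeff_of_ne _ (neg_ne_zero.2 k.2), coeff_coe] at this
  · intro h k
    rcases eq_or_ne k 0 with rfl | hk
    · simp
    · rw [coeff_of_ne _ (neg_ne_zero.2 hk), coeff_of_ne _ hk]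
      exact h ⟨k, hk⟩

theorem IsReal.add {u v : FourierSeries d} (hu : IsReal u) (hv : IsReal v) : IsReal (u + v) := by
  rw [isReal_iff] at *
  intro k
  rw [coeff_add, coeff_add, hu, hv, map_add]

theorem IsReal.smoothing {u : FourierSeries d} (hu : IsReal u) (γ₀ : ℝ) :
    IsReal (smoothing γ₀ u) := by
  rw [isReal_iff_freq] at *
  intro k
  simp only [LerayAlpha.smoothing, absFreq_neg, hu k, map_smul]

theorem IsReal.heat {u : FourierSeries d} (hu : IsReal u) (κ t : ℝ) : IsReal (heat κ t u) := by
  rw [isReal_iff_freq] at *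
  intro k
  simp only [LerayAlpha.heat, absFreq_neg, hu k, map_smul]

theorem IsReal.leray {u : FourierSeries d} (hu : IsReal u) : IsReal (leray u) := by
  rw [isReal_iff_freq] at *
  intro k
  simp only [LerayAlpha.leray, hu k, map_sub, conjVec_smul]
  congr 1
  ext i
  simp [neg_div]

theorem conjVec_transportTerm {V f : FourierSeries d} (hV : IsReal V) (hf : IsReal f)
    (k j : Fin d → ℤ) : transportTerm V f (-k) (-j) = conjVec d (transportTerm V f k j) := by
  rw [isReal_iff] at hV hf
  have h : -k - -j = -(k - j) := by abel
  rw [transportTerm, transportTerm, conjVec_smul, h, hf, hV]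
  congr 1
  simp only [conjVec_apply, Pi.neg_apply, Int.cast_neg, star_mul', Complex.star_def, map_sum,
    map_mul, Complex.conj_I, Complex.conj_ofReal, map_ofNat, Pi.sub_apply, map_intCast, mul_neg,
    neg_mul, Finset.sum_neg_distrib]

theorem IsReal.transport {V f : FourierSeries d} (hV : IsReal V) (hf : IsReal f) :
    IsReal (transport V f) := by
  rw [isReal_iff_freq]
  intro k
  rw [transport_apply, transport_apply, ← (Equiv.neg (Fin d → ℤ)).tsum_eq]
  have h := (conjVec d).toContinuousLinearEquiv.map_tsum (L := .unconditional _) (f := fun j => transportTerm V f k.1 j)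
  refine Eq.trans ?_ h.symm
  exact tsum_congr fun j => conjVec_transportTerm hV hf k.1 j

/-- The field with coefficients `∫₀ᵗ (P_{t-s} F_s)^_k ds`. -/
def duhamel (κ t : ℝ) (F : ℝ → FourierSeries d) : FourierSeries d :=
  fun k => ∫ s in (0 : ℝ)..t, heat κ (t - s) (F s) k

theorem isReal_duhamel {F : ℝ → FourierSeries d} (hF : ∀ s, IsReal (F s)) (κ t : ℝ) :
    IsReal (duhamel κ t F) := by
  rw [isReal_iff_freq]
  intro k
  have h (s : ℝ) := isReal_iff_freq.1 ((hF s).heat κ (t - s)) k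
  simp only [duhamel, h, intervalIntegral.intervalIntegral_eq_integral_uIoc, map_smul]
  congr 1
  exact (conjVec d).toContinuousLinearEquiv.integral_comp_comm _

/-! ### Completeness of the Sobolev spaces -/

theorem Sobolev.isometry_toL2 (d : ℕ) (s : ℝ) : Isometry (Sobolev.toL2 d s) :=
  AddMonoidHomClass.isometry_of_norm _ fun _ => rfl

theorem lp_continuous_apply (k : Freq d) :
    Continuous fun f : lp (fun _ : Freq d => EuclideanSpace ℂ (Fin d)) 2 => f k :=
  (lp.evalCLM ℝ (fun _ : Freq d => EuclideanSpace ℂ (Fin d)) (p := 2) k).continuous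

/-- The range of the isometry into `ℓ²` is cut out by the reality conditions, which are closed
because evaluation at a frequency is continuous. Completeness is needed for the Neumann series. -/
instance (d : ℕ) (s : ℝ) : CompleteSpace (Sobolev d s) := by
  rw [completeSpace_iff_isComplete_range (Sobolev.isometry_toL2 d s).isUniformInducing]
  have hr : Set.range (Sobolev.toL2 d s) =
      {f | ∀ k : Freq d, f ⟨-k.1, neg_ne_zero.2 k.2⟩ = conjVec d (f k)} := by
    ext f
    constructor
    · rintro ⟨u, rfl⟩ k
      have h := isReal_iff_freq.1 u.2.2 k
      change weighted s u.1 _ = conjVec d (weighted s u.1 k)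
      simp only [weighted, absFreq_neg, h, map_smul]
    · intro hf
      let u : FourierSeries d := fun k => (absFreq k.1 ^ (-s) : ℝ) • f k
      have hw : weighted s u = f := by
        funext k
        simp only [weighted, u, smul_smul]
        rw [← Real.rpow_add (absFreq_pos k)]
        simp
      have hu : u ∈ Sobolev d s := by
        refine ⟨by rw [hw]; exact f.2, isReal_iff_freq.2 fun k => ?_⟩
        simp only [u, absFreq_neg, map_smul]
        rw [hf k]
      exact ⟨⟨u, hu⟩, Subtype.ext hw⟩
  rw [hr]
  refine IsClosed.isComplete ?_
  rw [Set.ofPred_forall]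
  exact isClosed_iInter fun k => isClosed_eq (lp_continuous_apply _)
    ((conjVec d).continuous.comp (lp_continuous_apply _))

theorem Sobolev.continuous_apply {s : ℝ} (k : Freq d) :
    Continuous fun u : Sobolev d s => u.1 k := by
  have h : (fun u : Sobolev d s => u.1 k) =
      fun u => (absFreq k.1 ^ (-s) : ℝ) • (Sobolev.toL2 d s u) k := by
    funext u
    change u.1 k = (absFreq k.1 ^ (-s) : ℝ) • ((absFreq k.1 ^ s : ℝ) • u.1 k)
    rw [smul_smul, ← Real.rpow_add (absFreq_pos k)]
    simp
  have h2 : Continuous fun u : Sobolev d s => (Sobolev.toL2 d s u k : EuclideanSpace ℂ (Fin d)) :=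
    (lp_continuous_apply k).comp (Sobolev.isometry_toL2 d s).continuous
  rw [h]
  exact (continuous_const (y := (absFreq k.1 ^ (-s) : ℝ))).smul h2

theorem Sobolev.continuous_coeff {s : ℝ} (k : Fin d → ℤ) :
    Continuous fun u : Sobolev d s => coeff u.1 k := by
  rcases eq_or_ne k 0 with rfl | hk
  · simpa using continuous_const
  · simpa only [coeff_of_ne _ hk] using Sobolev.continuous_apply ⟨k, hk⟩

/-! ### Continuity from compactness -/

/-- The terms of the convergent series with exponent `-(d+1)` tend to zero along the cofinite
filter, and every negative power is a positive power of these terms. -/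
theorem tendsto_wt_cofinite {p : ℝ} (hp : p < 0) :
    Filter.Tendsto (wt p : (Fin d → ℤ) → ENNReal) Filter.cofinite (nhds 0) := by
  have h := ENNReal.tendsto_cofinite_zero_of_tsum_ne_top
    (tsum_wt_lt_top (d := d) (r := -((d : ℝ) + 1)) (by linarith)).ne
  have hq : 0 < p / -((d : ℝ) + 1) := div_pos_of_neg_of_neg hp (by linarith [Nat.cast_nonneg (α := ℝ) d])
  have h2 := (ENNReal.continuous_rpow_const (y := p / -((d : ℝ) + 1))).continuousAt.tendsto.comp h
  rw [ENNReal.zero_rpow_of_pos hq] at h2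
  refine h2.congr fun k => ?_
  rcases eq_or_ne k 0 with rfl | hk
  · simp only [Function.comp, wt_zero, ENNReal.zero_rpow_of_pos hq]
  · simp only [Function.comp, wt_of_ne _ hk]
    rw [ENNReal.ofReal_rpow_of_pos (Real.rpow_pos_of_pos (absFreq_pos_of_ne hk) _),
      ← Real.rpow_mul (absFreq_nonneg _), mul_div_cancel₀]
    linarith [Nat.cast_nonneg (α := ℝ) d]

theorem sobSq_sub_le (s : ℝ) (u v : FourierSeries d) :
    sobSq s (u - v) ≤ 2 * (sobSq s u + sobSq s v) := by
  rw [sobSq, sobSq, sobSq, ← ENNReal.tsum_add, ← ENNReal.tsum_mul_left]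
  refine ENNReal.tsum_le_tsum fun k => le_trans (pow_le_pow_left' ?_ 2) (add_sq_le _ _)
  rw [← mul_add, coeff_sub]
  exact mul_le_mul' le_rfl enorm_sub_le

/-- A family bounded in `H^{s'}` that is coefficientwise continuous is continuous in `H^s`
for `s < s'`. -/
theorem continuous_of_sobSq_bounded {X : Type*} [TopologicalSpace X] {s s' : ℝ} (hs : s < s')
    {w : X → Sobolev d s} {B : ENNReal} (hB : B ≠ ⊤) (hb : ∀ x, sobSq s' (w x).1 ≤ B)
    (hc : ∀ k, Continuous fun x => (w x).1 k) : Continuous w := by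
  rw [continuous_iff_continuousAt]
  intro x₀
  have key : Filter.Tendsto (fun x => sobSq s ((w x).1 - (w x₀).1)) (nhds x₀) (nhds 0) := by
    rw [ENNReal.tendsto_nhds_zero]
    intro ε hε
    -- `M` bounds the squared `H^{s'}` norm of every difference; the summand `1` only makes it
    -- nonzero, for division. Off the finite set `S` the weight ratio is at most `ε/2/M`, so the
    -- tail costs at most `ε/2`, and only finitely many continuous modes remain.
    set M : ENNReal := 2 * (B + B) + 1
    have hM : M ≠ ⊤ := by simp [M, hB, ENNReal.mul_eq_top]
    have hM0 : M ≠ 0 := by simp [M]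
    have hη : 0 < ε / 2 / M := ENNReal.div_pos (ENNReal.div_pos hε.ne' (by simp)).ne' hM
    have hfin := (ENNReal.tendsto_nhds_zero.1
      (tendsto_wt_cofinite (d := d) (p := 2 * (s - s')) (by linarith))) _ hη
    rw [Filter.eventually_cofinite] at hfin
    set S := hfin.toFinset
    have hcont : Filter.Tendsto (fun x => ∑ k ∈ S, (wt s k * ‖coeff ((w x).1 - (w x₀).1) k‖ₑ) ^ 2)
        (nhds x₀) (nhds 0) := by
      rw [show (0 : ENNReal) = ∑ k ∈ S, (wt s k * ‖coeff ((w x₀).1 - (w x₀).1) k‖ₑ) ^ 2 from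
        (Finset.sum_eq_zero fun k _ => by rw [coeff_sub, sub_self]; simp).symm]
      refine tendsto_finsetSum S fun k _ => ?_
      refine ENNReal.Tendsto.pow (ENNReal.Tendsto.const_mul ?_ (Or.inr (wt_ne_top s k)))
      have h1 : Continuous fun x => coeff ((w x).1 - (w x₀).1) k := by
        simp only [coeff_sub]
        refine Continuous.sub ?_ continuous_const
        rcases eq_or_ne k 0 with rfl | hk
        · simpa using continuous_const
        · simpa only [coeff_of_ne _ hk] using hc ⟨k, hk⟩
      exact h1.enorm.tendsto x₀
    filter_upwards [ENNReal.tendsto_nhds_zero.1 hcont (ε / 2) (ENNReal.div_pos hε.ne' (by simp))]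
      with x hx
    set δ := (w x).1 - (w x₀).1
    have hδ : sobSq s' δ ≤ M := (sobSq_sub_le _ _ _).trans
      ((mul_le_mul' le_rfl (add_le_add (hb x) (hb x₀))).trans le_self_add)
    have hsplit : sobSq s δ ≤ ∑ k ∈ S, (wt s k * ‖coeff δ k‖ₑ) ^ 2 + ε / 2 / M * sobSq s' δ := by
      rw [sobSq, ← ENNReal.sum_add_tsum_compl S]
      refine add_le_add le_rfl ?_
      rw [sobSq, ← ENNReal.tsum_mul_left]
      refine le_trans (ENNReal.tsum_le_tsum (g := fun k : ((S : Set (Fin d → ℤ))ᶜ : Set _) =>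
        ε / 2 / M * (wt s' k.1 * ‖coeff δ k.1‖ₑ) ^ 2) fun k => ?_)
        (ENNReal.tsum_comp_le_tsum_of_injective Subtype.val_injective _)
      have hk : wt (2 * (s - s')) k.1 ≤ ε / 2 / M := by
        by_contra hcon
        exact k.2 (by simpa [S] using hcon)
      rw [mul_pow, mul_pow, ← mul_assoc, wt_pow_two, wt_pow_two,
        show 2 * s = 2 * (s - s') + 2 * s' by ring, ← wt_mul]
      gcongr
    refine hsplit.trans ((add_le_add hx (mul_le_mul' le_rfl hδ)).trans_eq ?_)
    rw [ENNReal.div_mul_cancel hM0 hM, ENNReal.add_halves]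
  rw [ContinuousAt, tendsto_iff_edist_tendsto_0]
  have h3 := (ENNReal.continuous_rpow_const (y := (1 / 2 : ℝ))).continuousAt.tendsto.comp key
  rw [ENNReal.zero_rpow_of_pos (by norm_num)] at h3
  refine h3.congr fun x => ?_
  have h4 := Sobolev.enorm_sq_eq (w x - w x₀)
  rw [edist_eq_enorm_sub]
  simp only [Function.comp]
  rw [show (w x).1 - (w x₀).1 = (w x - w x₀).1 from rfl, ← h4, ← ENNReal.rpow_natCast,
    ← ENNReal.rpow_mul]
  norm_num

/-! ### The Helmholtz–Leray projection -/

theorem leray_add (u v : FourierSeries d) : leray (u + v) = leray u + leray v := by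
  funext k
  change (u k + v k) - _ = (u k - _) + (v k - _)
  have h : ∑ i, (k.1 i : ℂ) * (u + v) k i =
      ∑ i, (k.1 i : ℂ) * u k i + ∑ i, (k.1 i : ℂ) * v k i := by
    rw [← Finset.sum_add_distrib]
    exact Finset.sum_congr rfl fun i _ => mul_add _ _ _
  rw [h, add_div, add_smul]
  abel

theorem leray_smul (c : ℝ) (u : FourierSeries d) : leray (c • u) = c • leray u := by
  funext k
  change c • u k - _ = c • (u k - _)
  have h : ∑ i, (k.1 i : ℂ) * (c • u) k i = (c : ℂ) * ∑ i, (k.1 i : ℂ) * u k i := by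
    rw [Finset.mul_sum]
    refine Finset.sum_congr rfl fun i _ => ?_
    change (k.1 i : ℂ) * ((c : ℝ) • u k i) = _
    rw [Complex.real_smul]; ring
  rw [h, smul_sub, mul_div_assoc, mul_smul]
  rfl

theorem sum_mul_eq_inner (k : Fin d → ℤ) (v : EuclideanSpace ℂ (Fin d)) :
    ∑ i, (k i : ℂ) * v i = inner ℂ (WithLp.toLp 2 fun i => (k i : ℂ)) v := by
  simp [PiLp.inner_apply, mul_comm]

theorem sum_sq_eq_norm_sq (k : Fin d → ℤ) :
    ∑ i, (k i : ℂ) ^ 2 = ((‖(WithLp.toLp 2 fun i => (k i : ℂ) : EuclideanSpace ℂ (Fin d))‖ ^ 2 : ℝ) : ℂ) := by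
  rw [EuclideanSpace.norm_sq_eq]; simp

theorem norm_leray_le (u : FourierSeries d) (k : Freq d) : ‖leray u k‖ ≤ 2 * ‖u k‖ := by
  rw [leray, sum_mul_eq_inner, sum_sq_eq_norm_sq]
  set K : EuclideanSpace ℂ (Fin d) := WithLp.toLp 2 fun i => (k.1 i : ℂ)
  refine (norm_sub_le _ _).trans ?_
  rw [norm_smul, norm_div, Complex.norm_real, Real.norm_of_nonneg (sq_nonneg _)]
  have h := norm_inner_le_norm (𝕜 := ℂ) K (u k)
  rcases eq_or_ne ‖K‖ 0 with h0 | h0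
  · rw [h0]; simp; linarith [norm_nonneg (u k)]
  have hp : 0 < ‖K‖ := lt_of_le_of_ne (norm_nonneg _) (Ne.symm h0)
  have h2 : ‖inner ℂ K (u k)‖ / ‖K‖ ^ 2 * ‖K‖ ≤ ‖u k‖ := by
    rw [div_mul_eq_mul_div, div_le_iff₀ (by positivity)]
    nlinarith
  linarith

theorem enorm_leray_le (u : FourierSeries d) (k : Freq d) : ‖leray u k‖ₑ ≤ 2 * ‖u k‖ₑ := by
  have h := ENNReal.ofReal_le_ofReal (norm_leray_le u k)
  rwa [ENNReal.ofReal_mul (by norm_num), ofReal_norm, ofReal_norm, ENNReal.ofReal_ofNat] at h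

/-- The projection subtracts a multiple of `k`, which is orthogonal to `û_k`. Hence the projection
disappears from the energy balance. -/
theorem inner_leray_of_isDivFree {u v : FourierSeries d} (hu : IsDivFree u) (k : Freq d) :
    inner ℂ (u k) (leray v k) = inner ℂ (u k) (v k) := by
  have h := hu k
  rw [sum_mul_eq_inner] at h
  rw [leray, inner_sub_right, inner_smul_right,
    ← inner_conj_symm (u k) (WithLp.toLp 2 fun i => (k.1 i : ℂ)), h]
  simp

/-! ### Bilinearity, measurability and skew symmetry of the transport term -/

theorem summable_of_tsum_enorm_ne_top {ι E : Type*} [NormedAddCommGroup E] [CompleteSpace E]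
    {f : ι → E} (h : ∑' i, ‖f i‖ₑ ≠ ⊤) : Summable f := by
  refine Summable.of_norm ?_
  refine (ENNReal.summable_toReal h).congr fun i => ?_
  simp

theorem summable_transportTerm {V f : FourierSeries d} {k : Fin d → ℤ}
    (h : absTransport V f k ≠ ⊤) : Summable (transportTerm V f k) :=
  summable_of_tsum_enorm_ne_top h

theorem enorm_tsum_le_tsum_enorm {ι E : Type*} [NormedAddCommGroup E] [CompleteSpace E]
    (f : ι → E) : ‖∑' i, f i‖ₑ ≤ ∑' i, ‖f i‖ₑ := by
  rcases eq_or_ne (∑' i, ‖f i‖ₑ) ⊤ with h | h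
  · rw [h]; exact le_top
  have hs : Summable fun i => ‖f i‖ := (ENNReal.summable_toReal h).congr fun i => by simp
  rw [← ofReal_norm]
  refine (ENNReal.ofReal_le_ofReal (norm_tsum_le_tsum_norm hs)).trans_eq ?_
  rw [ENNReal.ofReal_tsum_of_nonneg (fun _ => norm_nonneg _) hs]
  simp only [ofReal_norm]

theorem enorm_transport_le (V f : FourierSeries d) (k : Freq d) :
    ‖transport V f k‖ₑ ≤ absTransport V f k.1 := enorm_tsum_le_tsum_enorm _

theorem smoothing_add (γ₀ : ℝ) (u v : FourierSeries d) :
    smoothing γ₀ (u + v) = smoothing γ₀ u + smoothing γ₀ v := funext fun _ => smul_add _ _ _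

theorem smoothing_smul (γ₀ c : ℝ) (u : FourierSeries d) :
    smoothing γ₀ (c • u) = c • smoothing γ₀ u := funext fun k => smul_comm _ c (u k)

theorem heat_smul (κ t c : ℝ) (u : FourierSeries d) :
    heat κ t (c • u) = c • heat κ t u := funext fun k => smul_comm _ c (u k)

theorem transportTerm_add_left (V W f : FourierSeries d) (k j : Fin d → ℤ) :
    transportTerm (V + W) f k j = transportTerm V f k j + transportTerm W f k j := by
  simp only [transportTerm, coeff_add, PiLp.add_apply, add_mul, Finset.sum_add_distrib, mul_add,
    add_smul]

theorem transportTerm_add_right (V f g : FourierSeries d) (k j : Fin d → ℤ) :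
    transportTerm V (f + g) k j = transportTerm V f k j + transportTerm V g k j := by
  simp only [transportTerm, coeff_add, smul_add]

theorem transportTerm_smul_left (c : ℝ) (V f : FourierSeries d) (k j : Fin d → ℤ) :
    transportTerm (c • V) f k j = c • transportTerm V f k j := by
  simp only [transportTerm, coeff_smul, PiLp.smul_apply, Complex.real_smul, mul_assoc,
    ← Finset.mul_sum]
  rw [← Complex.coe_smul, smul_smul]
  congr 1
  ring

theorem transportTerm_smul_right (c : ℝ) (V f : FourierSeries d) (k j : Fin d → ℤ) :
    transportTerm V (c • f) k j = c • transportTerm V f k j := by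
  simp only [transportTerm, coeff_smul]
  rw [smul_comm]

theorem transport_add_left {V W f : FourierSeries d} {k : Freq d}
    (hV : absTransport V f k.1 ≠ ⊤) (hW : absTransport W f k.1 ≠ ⊤) :
    transport (V + W) f k = transport V f k + transport W f k := by
  simp only [transport_apply, transportTerm_add_left]
  exact (summable_transportTerm hV).tsum_add (summable_transportTerm hW)

theorem transport_add_right {V f g : FourierSeries d} {k : Freq d}
    (hf : absTransport V f k.1 ≠ ⊤) (hg : absTransport V g k.1 ≠ ⊤) :
    transport V (f + g) k = transport V f k + transport V g k := by
  simp only [transport_apply, transportTerm_add_right]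
  exact (summable_transportTerm hf).tsum_add (summable_transportTerm hg)

theorem transport_smul_left (c : ℝ) (V f : FourierSeries d) :
    transport (c • V) f = c • transport V f := by
  funext k
  change transport (c • V) f k = c • transport V f k
  simp only [transport_apply, transportTerm_smul_left]
  exact tsum_const_smul'' c

theorem transport_smul_right (c : ℝ) (V f : FourierSeries d) :
    transport V (c • f) = c • transport V f := by
  funext k
  change transport V (c • f) k = c • transport V f k
  simp only [transport_apply, transportTerm_smul_right]
  exact tsum_const_smul'' c

theorem continuous_transportTerm {X : Type*} [TopologicalSpace X] {V f : X → FourierSeries d}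
    (hV : ∀ k, Continuous fun x => coeff (V x) k) (hf : ∀ k, Continuous fun x => coeff (f x) k)
    (k j : Fin d → ℤ) : Continuous fun x => transportTerm (V x) (f x) k j := by
  have hVl (l : Fin d) : Continuous fun x => coeff (V x) j l :=
    (EuclideanSpace.proj (𝕜 := ℂ) l).continuous.comp (hV j)
  unfold transportTerm
  exact (continuous_const.mul (continuous_finsetSum _ fun l _ => (hVl l).mul continuous_const)).smul
    (hf _)

/-- At almost every time the defining series converges, so the coefficient is an almost everywhere
limit of finite sums of continuous functions. Continuity in time itself may fail, as convergence is
only assumed almost everywhere. -/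
theorem aestronglyMeasurable_transport {μ : Measure ℝ} {V f : ℝ → FourierSeries d}
    (hV : ∀ k, Continuous fun x => coeff (V x) k) (hf : ∀ k, Continuous fun x => coeff (f x) k)
    (k : Freq d) (h : ∀ᵐ x ∂μ, absTransport (V x) (f x) k.1 ≠ ⊤) :
    AEStronglyMeasurable (fun x => transport (V x) (f x) k) μ := by
  refine aestronglyMeasurable_of_tendsto_ae Filter.atTop
    (f := fun (s : Finset (Fin d → ℤ)) x => ∑ j ∈ s, transportTerm (V x) (f x) k.1 j) (fun s => ?_) ?_
  · exact (continuous_finsetSum _ fun j _ =>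
      continuous_transportTerm hV hf k.1 j).aestronglyMeasurable
  · filter_upwards [h] with x hx
    exact (summable_transportTerm hx).hasSum

theorem continuous_coeff_smoothing {X : Type*} [TopologicalSpace X] {V : X → FourierSeries d}
    (hV : ∀ k, Continuous fun x => coeff (V x) k) (γ₀ : ℝ) (k : Fin d → ℤ) :
    Continuous fun x => coeff (smoothing γ₀ (V x)) k := by
  rcases eq_or_ne k 0 with rfl | hk
  · simpa using continuous_const
  · have h := hV k
    simp only [coeff_of_ne _ hk] at h ⊢
    exact (continuous_const (y := (1 / (1 + absFreq k ^ (2 * γ₀)) : ℝ))).smul h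

theorem leray_eq_of_eq {u v : FourierSeries d} {k : Freq d} (h : u k = v k) :
    leray u k = leray v k := by
  simp only [leray, h]

/-- The Helmholtz–Leray projection on a single Fourier mode. -/
def lerayMode (k : Freq d) (v : EuclideanSpace ℂ (Fin d)) : EuclideanSpace ℂ (Fin d) :=
  v - ((∑ i, (k.1 i : ℂ) * v i) / (∑ i, (k.1 i : ℂ) ^ 2)) • WithLp.toLp 2 (fun i => (k.1 i : ℂ))

theorem leray_apply (u : FourierSeries d) (k : Freq d) : leray u k = lerayMode k (u k) := rfl

theorem continuous_lerayMode (k : Freq d) : Continuous (lerayMode k) := by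
  have h (l : Fin d) : Continuous fun v : EuclideanSpace ℂ (Fin d) => v l :=
    (EuclideanSpace.proj (𝕜 := ℂ) l).continuous
  have h2 : Continuous fun v : EuclideanSpace ℂ (Fin d) =>
      (∑ i, (k.1 i : ℂ) * v i) / (∑ i, (k.1 i : ℂ) ^ 2) :=
    (continuous_finsetSum _ fun l _ => continuous_const.mul (h l)).div_const _
  exact continuous_id.sub (h2.smul continuous_const)

/-- With the derivative moved to `k`, each coefficient is a convolution of two `ℓ²` sequences, hence
bounded by Cauchy–Schwarz. Thus a fixed mode of the nonlinearity makes sense on `L²` alone and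
depends continuously on time, which the modewise energy balance requires. -/
theorem absTransport_smoothing_le_of_isDivFree {γ₀ : ℝ} (hγ₀ : 0 ≤ γ₀) (v f : Sobolev d 0)
    (hv : IsDivFree v.1) (k : Freq d) :
    absTransport (smoothing γ₀ v.1) f.1 k.1 ≤ wt 1 k.1 * (‖v‖ₑ * ‖f‖ₑ) := by
  have h1 : absTransport (smoothing γ₀ v.1) f.1 k.1 ≤
      wt 1 k.1 * conv (fun j => ‖coeff v.1 j‖ₑ) (fun j => ‖coeff f.1 j‖ₑ) k.1 := by
    rw [conv, ← ENNReal.tsum_mul_left]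
    refine ENNReal.tsum_le_tsum fun j => (enorm_transportTerm_le_of_isDivFree
      (isDivFree_smoothing hv) _ k.2 j).trans (mul_le_mul' le_rfl (mul_le_mul' ?_ le_rfl))
    refine (enorm_coeff_smoothing_le _ _ _).trans (mul_le_of_le_one_left' ?_)
    exact (wt_mono (by linarith) _).trans (wt_exponent_zero_le _)
  refine h1.trans (mul_le_mul' le_rfl (le_of_sq_le_sq ?_))
  refine (conv_sq_le _ _ _).trans_eq ?_
  have h2 (u : Sobolev d 0) : ∑' j, ‖coeff u.1 j‖ₑ ^ 2 = ‖u‖ₑ ^ 2 := by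
    rw [Sobolev.enorm_sq_eq, sobSq]
    refine tsum_congr fun j => ?_
    rcases eq_or_ne j 0 with rfl | hj
    · simp
    · rw [wt_exponent_zero hj, one_mul]
  rw [h2, h2, mul_pow]

theorem norm_transport_smoothing_le {γ₀ : ℝ} (hγ₀ : 0 ≤ γ₀) (v f : Sobolev d 0)
    (hv : IsDivFree v.1) (k : Freq d) :
    ‖transport (smoothing γ₀ v.1) f.1 k‖ ≤ absFreq k.1 * (‖v‖ * ‖f‖) := by
  have h := (enorm_transport_le _ _ k).trans (absTransport_smoothing_le_of_isDivFree hγ₀ v f hv k)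
  rw [wt_of_ne _ k.2, Real.rpow_one, ← ofReal_norm, ← ofReal_norm, ← ofReal_norm,
    ← ENNReal.ofReal_mul (norm_nonneg _), ← ENNReal.ofReal_mul (absFreq_nonneg _)] at h
  exact (ENNReal.ofReal_le_ofReal_iff (mul_nonneg (absFreq_nonneg _) (by positivity))).1 h

theorem isDivFree_sub {u v : FourierSeries d} (hu : IsDivFree u) (hv : IsDivFree v) :
    IsDivFree (u - v) := by
  intro k
  have h : ∑ i, (k.1 i : ℂ) * (u - v) k i =
      ∑ i, (k.1 i : ℂ) * u k i - ∑ i, (k.1 i : ℂ) * v k i := by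
    rw [← Finset.sum_sub_distrib]
    exact Finset.sum_congr rfl fun i _ => mul_sub _ _ _
  rw [h, hu k, hv k, sub_zero]

theorem continuous_transport_smoothing_self {X : Type*} [TopologicalSpace X] {γ₀ : ℝ}
    (hγ₀ : 0 ≤ γ₀) {u : X → Sobolev d 0} (hu : Continuous u) (hdiv : ∀ x, IsDivFree (u x).1)
    (k : Freq d) : Continuous fun x => transport (smoothing γ₀ (u x).1) (u x).1 k := by
  have hfin (v f : Sobolev d 0) (hv : IsDivFree v.1) :
      absTransport (smoothing γ₀ v.1) f.1 k.1 ≠ ⊤ :=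
    ((absTransport_smoothing_le_of_isDivFree hγ₀ v f hv k).trans_lt (ENNReal.mul_lt_top
      (wt_ne_top _ _).lt_top (ENNReal.mul_lt_top enorm_lt_top enorm_lt_top))).ne
  -- Bilinearity: `B(v,v) - B(w,w) = B(v-w,v) + B(w,v-w)`, each term being bounded as above.
  have hdiff (v w : Sobolev d 0) (hv : IsDivFree v.1) (hw : IsDivFree w.1) :
      ‖transport (smoothing γ₀ v.1) v.1 k - transport (smoothing γ₀ w.1) w.1 k‖ ≤
        absFreq k.1 * (‖v - w‖ * ‖v‖) + absFreq k.1 * (‖w‖ * ‖v - w‖) := by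
    have hvw : IsDivFree (v - w).1 := isDivFree_sub hv hw
    have e1 : transport (smoothing γ₀ v.1) v.1 k =
        transport (smoothing γ₀ (v - w).1) v.1 k + transport (smoothing γ₀ w.1) v.1 k := by
      rw [← transport_add_left (hfin _ _ hvw) (hfin _ _ hw), ← smoothing_add]
      congr 3
      exact (sub_add_cancel v.1 w.1).symm
    have e2 : transport (smoothing γ₀ w.1) v.1 k =
        transport (smoothing γ₀ w.1) (v - w).1 k + transport (smoothing γ₀ w.1) w.1 k := by
      rw [← transport_add_right (hfin _ _ hw) (hfin _ _ hw)]
      congr 1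
      exact (sub_add_cancel v.1 w.1).symm
    rw [e1, e2, ← add_assoc, add_sub_cancel_right]
    exact (norm_add_le _ _).trans (add_le_add (norm_transport_smoothing_le hγ₀ _ _ hvw k)
      (norm_transport_smoothing_le hγ₀ _ _ hw k))
  rw [continuous_iff_continuousAt]
  intro x₀
  rw [ContinuousAt, tendsto_iff_norm_sub_tendsto_zero]
  refine squeeze_zero (fun _ => norm_nonneg _) (fun x => hdiff (u x) (u x₀) (hdiv x) (hdiv x₀)) ?_
  have hc : Continuous fun x => absFreq k.1 * (‖u x - u x₀‖ * ‖u x‖)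
      + absFreq k.1 * (‖u x₀‖ * ‖u x - u x₀‖) := by fun_prop
  have := hc.tendsto x₀
  simpa using this

/-- The transport by a real divergence-free field is skew symmetric. -/
theorem hasSum_re_inner_transport {V u : FourierSeries d} (hV : IsDivFree V) (hVr : IsReal V)
    (h : ∑' k, ‖coeff u k‖ₑ * absTransport V u k ≠ ⊤) :
    HasSum (fun k : Freq d => (inner ℂ (u k) (transport V u k)).re) 0 := by
  -- The trilinear form indexed by the output frequency `k` and the frequency `l` of the transported
  -- field, with `V` evaluated at `k - l`. In these variables skew symmetry is antisymmetry under
  -- swapping, and absolute summability turns it into a vanishing total.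
  let Q : (Fin d → ℤ) × (Fin d → ℤ) → ℝ :=
    fun p => (inner ℂ (coeff u p.1) (transportTerm V u p.1 (p.1 - p.2))).re
  have hskew (p : (Fin d → ℤ) × (Fin d → ℤ)) : Q p.swap = -Q p := by
    obtain ⟨k, l⟩ := p
    simp only [Q, Prod.swap, transportTerm_of_isDivFree hV, sub_sub_cancel, inner_smul_right]
    -- Divergence freeness replaces `l` by `k`, and reality replaces `V̂_{l-k}` by the conjugate of
    -- `V̂_{k-l}`.
    have h1 : ∑ m, coeff V (l - k) m * (l m : ℂ) = star (∑ m, coeff V (k - l) m * (k m : ℂ)) := by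
      have h2 := hV.sum_coeff (l - k)
      simp only [Pi.sub_apply, Int.cast_sub, mul_sub, Finset.sum_sub_distrib] at h2
      rw [sub_eq_zero.1 h2, star_sum]
      refine Finset.sum_congr rfl fun m _ => ?_
      rw [← neg_sub k l, hVr (k - l) m]
      simp
    rw [h1, ← inner_conj_symm (coeff u l) (coeff u k), ← Complex.conj_re]
    simp only [map_mul, Complex.star_def, Complex.conj_conj, Complex.conj_I, Complex.conj_ofReal,
      map_ofNat]
    rw [← Complex.neg_re]
    congr 1
    ring
  have hfiber (k : Fin d → ℤ) : ∑' l, ‖Q (k, l)‖ₑ ≤ ‖coeff u k‖ₑ * absTransport V u k := by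
    rw [absTransport, ← tsum_sub_left (fun j => ‖transportTerm V u k j‖ₑ) k,
      ← ENNReal.tsum_mul_left]
    refine ENNReal.tsum_le_tsum fun l => ?_
    have h1 : ‖Q (k, l)‖ ≤ ‖coeff u k‖ * ‖transportTerm V u k (k - l)‖ :=
      (Complex.abs_re_le_norm _).trans (norm_inner_le_norm _ _)
    rw [← ofReal_norm, ← ofReal_norm, ← ofReal_norm, ← ENNReal.ofReal_mul (norm_nonneg _)]
    exact ENNReal.ofReal_le_ofReal h1
  have hsum : Summable Q := by
    refine summable_of_tsum_enorm_ne_top ?_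
    rw [ENNReal.tsum_prod']
    exact ((ENNReal.tsum_le_tsum hfiber).trans_lt h.lt_top).ne
  have hzero : ∑' p, Q p = 0 := by
    have h1 := (Equiv.prodComm (Fin d → ℤ) (Fin d → ℤ)).tsum_eq Q
    have h2 : ∑' p, Q (Equiv.prodComm (Fin d → ℤ) (Fin d → ℤ) p) = -∑' p, Q p := by
      rw [← tsum_neg]
      exact tsum_congr hskew
    linarith
  have hrow (k : Freq d) : ∑' l, Q (k.1, l) = (inner ℂ (u k) (transport V u k)).re := by
    rcases eq_or_ne (u k) 0 with h0 | h0
    · simp [Q, h0]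
    have hk : absTransport V u k.1 ≠ ⊤ := by
      intro htop
      refine h (ENNReal.tsum_eq_top_of_eq_top ⟨k.1, ?_⟩)
      rw [htop, coeff_coe, ENNReal.mul_top (by simpa using h0)]
    rw [transport_apply]
    have hs := summable_transportTerm hk
    have h1 : HasSum (fun j => (inner ℂ (u k) (transportTerm V u k.1 j)).re)
        (inner ℂ (u k) (∑' j, transportTerm V u k.1 j)).re :=
      (hs.hasSum.mapL (innerSL ℂ (u k))).mapL Complex.reCLM
    rw [← h1.tsum_eq, ← (Equiv.subLeft k.1).tsum_eq]
    simp [Q]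
  have h3 := hsum.hasSum.prod_fiberwise fun k => (hsum.prod_factor k).hasSum
  rw [hzero] at h3
  have h4 : Function.support (fun k : Fin d → ℤ => ∑' l, Q (k, l)) ⊆ {k | k ≠ 0} := by
    intro k hk
    rintro rfl
    exact hk (by simp [Q])
  have h5 := (hasSum_subtype_iff_of_support_subset h4).2 h3
  exact h5.congr_fun fun k => (hrow k).symm

/-! ### The energy inequality -/

/-- Energy balance for the mild form of `c' = -a c - F`. -/
theorem norm_sq_add_integral_eq {E : Type*} [NormedAddCommGroup E] [InnerProductSpace ℝ E]
    [CompleteSpace E] {a t : ℝ} (ht : 0 ≤ t) {c F : ℝ → E} {c₀ : E} (hF : Continuous F)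
    (hc : ∀ s ∈ Set.Icc 0 t, c s = Real.exp (-(a * s)) • c₀
      - ∫ r in (0 : ℝ)..s, Real.exp (-(a * (s - r))) • F r) :
    ‖c t‖ ^ 2 + 2 * a * ∫ s in (0 : ℝ)..t, ‖c s‖ ^ 2
      = ‖c₀‖ ^ 2 - 2 * ∫ s in (0 : ℝ)..t, inner ℝ (c s) (F s) := by
  let G : ℝ → E := fun r => Real.exp (a * r) • F r
  have hG : Continuous G := by fun_prop
  -- The integrating-factor form of the Duhamel formula, defined and differentiable on all of `ℝ`;
  -- `c` itself is only known on `[0,t]`.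
  let W : ℝ → E := fun s => Real.exp (-(a * s)) • (c₀ - ∫ r in (0 : ℝ)..s, G r)
  have hcW : ∀ s ∈ Set.Icc 0 t, c s = W s := by
    intro s hs
    rw [hc s hs]
    simp only [W, G, smul_sub]
    rw [← intervalIntegral.integral_smul]
    congr 1
    refine intervalIntegral.integral_congr fun r _ => ?_
    simp only [smul_smul, ← Real.exp_add]
    congr 2
    ring
  have hW (s : ℝ) : HasDerivAt W (-a • W s - F s) s := by
    have h1 : HasDerivAt (fun s => c₀ - ∫ r in (0 : ℝ)..s, G r) (-G s) s := by
      have := (intervalIntegral.integral_hasDerivAt_right (hG.intervalIntegrable 0 s)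
        (hG.stronglyMeasurableAtFilter _ _) hG.continuousAt).const_sub c₀
      exact this
    have h2 : HasDerivAt (fun s => Real.exp (-(a * s))) (-a * Real.exp (-(a * s))) s := by
      have := ((hasDerivAt_id s).const_mul a).neg.exp
      simpa [mul_comm] using this
    have h3 := h2.smul h1
    refine h3.congr_deriv ?_
    simp only [W, G, smul_neg, smul_smul, ← Real.exp_add]
    rw [neg_add_cancel, Real.exp_zero, one_smul]
    abel
  have hWc : Continuous W := continuous_iff_continuousAt.2 fun s => (hW s).continuousAt
  have h4 := intervalIntegral.integral_eq_sub_of_hasDerivAt (a := 0) (b := t)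
    (f := fun s => ‖W s‖ ^ 2) (f' := fun s => 2 * inner ℝ (W s) (-a • W s - F s))
    (fun s _ => (hW s).norm_sq) (Continuous.intervalIntegrable (by fun_prop) _ _)
  have h5 (s : ℝ) : 2 * inner ℝ (W s) (-a • W s - F s) =
      -(2 * a) * ‖W s‖ ^ 2 - 2 * inner ℝ (W s) (F s) := by
    rw [inner_sub_right, inner_smul_right, real_inner_self_eq_norm_sq]; ring
  simp only [h5] at h4
  rw [intervalIntegral.integral_sub (Continuous.intervalIntegrable (by fun_prop) _ _)
    (Continuous.intervalIntegrable (by fun_prop) _ _), intervalIntegral.integral_const_mul,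
    intervalIntegral.integral_const_mul] at h4
  have h6 : W 0 = c₀ := by simp [W]
  have h7 : ∫ s in (0 : ℝ)..t, ‖c s‖ ^ 2 = ∫ s in (0 : ℝ)..t, ‖W s‖ ^ 2 :=
    intervalIntegral.integral_congr fun s hs => by
      rw [Set.uIcc_of_le ht] at hs; simp only [hcW s hs]
  have h8 : ∫ s in (0 : ℝ)..t, inner ℝ (c s) (F s) = ∫ s in (0 : ℝ)..t, inner ℝ (W s) (F s) :=
    intervalIntegral.integral_congr fun s hs => by
      rw [Set.uIcc_of_le ht] at hs; simp only [hcW s hs]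
  rw [h7, h8, hcW t ⟨ht, le_rfl⟩]
  rw [h6] at h4
  linarith

theorem real_inner_eq_re (v w : EuclideanSpace ℂ (Fin d)) : inner ℝ v w = (inner ℂ v w).re := by
  simp [PiLp.inner_apply, Complex.inner, mul_comm]

theorem measurable_sobSq {u : ℝ → FourierSeries d} (hu : ∀ k, Continuous fun x => coeff (u x) k)
    (s : ℝ) : Measurable fun x => sobSq s (u x) :=
  Measurable.tsum fun k => ((hu k).enorm.measurable.const_mul _).pow_const 2

/-- For `u ∈ H¹` the product `K(u)·∇u` lies in `L²`, by the transport estimate with `s = 1` and `a =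
0`; pairing with `u` is Cauchy–Schwarz. The bound is integrable in time for an energy solution, so
it justifies both the cancellation and the exchange of sum and integral. -/
theorem exists_tsum_enorm_mul_absTransport_le {γ₀ : ℝ} (hγ₀ : 0 ≤ γ₀)
    (hd : (d : ℝ) / 2 < 2 * γ₀ + 1) : ∃ C : ENNReal, C ≠ ⊤ ∧ ∀ u : Sobolev d 0,
      ∑' k, ‖coeff u.1 k‖ₑ * absTransport (smoothing γ₀ u.1) u.1 k ≤ C * ‖u‖ₑ * sobSq 1 u.1 := by
  obtain ⟨C, hC, h⟩ := exists_absTransport_smoothing_le (d := d) (γ₀ := γ₀) (s := 1) (a := 0)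
    le_rfl (by linarith) (by linarith)
  refine ⟨C ^ (1 / 2 : ℝ), ENNReal.rpow_ne_top_of_nonneg (by norm_num) hC, fun u => ?_⟩
  have hC2 : (C ^ (1 / 2 : ℝ)) ^ 2 = C := by
    rw [← ENNReal.rpow_natCast, ← ENNReal.rpow_mul]; norm_num
  refine le_of_sq_le_sq ?_
  have h1 : ∑' k, ‖coeff u.1 k‖ₑ * absTransport (smoothing γ₀ u.1) u.1 k =
      ∑' k, (wt 0 k * ‖coeff u.1 k‖ₑ) * (wt (-0) k * absTransport (smoothing γ₀ u.1) u.1 k) := by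
    refine tsum_congr fun k => ?_
    rcases eq_or_ne k 0 with rfl | hk
    · simp
    · rw [neg_zero, wt_exponent_zero hk, one_mul, one_mul]
  rw [h1]
  refine (tsum_mul_sq_le _ _).trans ((mul_le_mul' le_rfl (h u.1 u.1)).trans_eq ?_)
  rw [show (∑' k, (wt 0 k * ‖coeff u.1 k‖ₑ) ^ 2) = sobSq 0 u.1 from rfl, ← Sobolev.enorm_sq_eq,
    mul_pow, mul_pow, hC2]
  ring

/-- The energy inequality for solutions of the viscous Leray-`α` model. -/
theorem IsLerayAlphaSolution.energy_le {κ γ₀ T : ℝ} {hT : 0 ≤ T} {u₀ : Sobolev d 0}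
    {u : C(Set.Icc (0 : ℝ) T, Sobolev d 0)} (h : IsLerayAlphaSolution κ γ₀ T hT u₀ u)
    (hκ : 0 ≤ viscConst d * κ) (hγ₀ : 0 ≤ γ₀) (hd : (d : ℝ) / 2 < 2 * γ₀ + 1)
    (t : Set.Icc (0 : ℝ) T) :
    ‖u t‖ₑ ^ 2 + ENNReal.ofReal (2 * (viscConst d * κ)) *
      ∫⁻ s in Set.Ioc (0 : ℝ) t, sobSq 1 (u (Set.projIcc 0 T hT s)).1 ≤ ‖u₀‖ₑ ^ 2 := by
  set ν := viscConst d * κ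
  let U : ℝ → Sobolev d 0 := fun s => u (Set.projIcc 0 T hT s)
  have hUc : Continuous U := u.continuous.comp continuous_projIcc
  have hUk (k : Fin d → ℤ) : Continuous fun s => coeff (U s).1 k :=
    (Sobolev.continuous_coeff k).comp hUc
  have hUk' (k : Freq d) : Continuous fun s => (U s).1 k :=
    (Sobolev.continuous_apply k).comp hUc
  have hdiv (s : ℝ) : IsDivFree (U s).1 := h.divFree _
  let F : Freq d → ℝ → EuclideanSpace ℂ (Fin d) :=
    fun k s => leray (transport (smoothing γ₀ (U s).1) (U s).1) k
  have hFc (k : Freq d) : Continuous (F k) := by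
    simp only [F, leray_apply]
    exact (continuous_lerayMode k).comp (continuous_transport_smoothing_self hγ₀ hUc hdiv k)
  have ht0 : (0 : ℝ) ≤ t := t.2.1
  have hmode (k : Freq d) : ‖(u t).1 k‖ ^ 2 +
      2 * (ν * absFreq k.1 ^ 2) * ∫ s in (0 : ℝ)..t, ‖(U s).1 k‖ ^ 2 =
      ‖u₀.1 k‖ ^ 2 - 2 * ∫ s in (0 : ℝ)..t, (inner ℂ ((U s).1 k) (F k s)).re := by
    have h1 := norm_sq_add_integral_eq (a := ν * absFreq k.1 ^ 2) ht0 (c := fun s => (U s).1 k)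
      (c₀ := u₀.1 k) (hFc k) (fun s hs => by
        have hsT : s ∈ Set.Icc 0 T := ⟨hs.1, hs.2.trans t.2.2⟩
        have h2 := (h.mild ⟨s, hsT⟩ k).2
        have h3 : U s = u ⟨s, hsT⟩ := by simp only [U, Set.projIcc_of_mem hT hsT]
        refine (congrArg (fun v : Sobolev d 0 => v.1 k) h3).trans (h2.trans ?_)
        simp only [heat]
        have h4 (r : ℝ) : -(viscConst d * κ * r * absFreq k.1 ^ 2) =
            -(ν * absFreq k.1 ^ 2 * r) := by simp only [ν]; ring
        simp only [h4]
        rfl)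
    have h3 : U t = u t := by simp only [U, Set.projIcc_val]
    simp only [h3, real_inner_eq_re] at h1
    exact h1
  obtain ⟨C, hC, hCb⟩ := exists_tsum_enorm_mul_absTransport_le hγ₀ hd
  let f : Freq d → ℝ → ℝ := fun k s => (inner ℂ ((U s).1 k) (F k s)).re
  have hfeq (k : Freq d) (s : ℝ) : f k s =
      (inner ℂ ((U s).1 k) (transport (smoothing γ₀ (U s).1) (U s).1 k)).re := by
    simp only [f, F, inner_leray_of_isDivFree (hdiv s)]
  have hfc (k : Freq d) : Continuous (f k) :=
    Complex.continuous_re.comp ((hUk' k).inner (hFc k))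
  have hfin : ∫⁻ s in Set.Ioc (0 : ℝ) t, sobSq 1 (U s).1 < ⊤ := by
    refine lt_of_le_of_lt (lintegral_mono_set (Set.Ioc_subset_Icc_self.trans
      (Set.Icc_subset_Icc_right t.2.2))) ?_
    have := h.sq_integrable
    simpa only [sobolevOneSq_eq] using this
  -- Dominated by `C‖u‖ ‖u_s‖²_{H¹}`, the sum over modes may be taken inside the time integral,
  -- where it vanishes by skew symmetry at almost every time.
  have hsum : HasSum (fun k => ∫ s in (0 : ℝ)..t, f k s) 0 := by
    have hnorm : ∑' k, ∫⁻ s in Set.Ioc (0 : ℝ) t, ‖f k s‖ₑ ≠ ⊤ := by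
      rw [← lintegral_tsum fun k => (hfc k).enorm.aemeasurable]
      refine ne_top_of_le_ne_top ?_ (lintegral_mono (μ := volume.restrict (Set.Ioc (0 : ℝ) t))
        (g := fun s => C * ‖u‖ₑ * sobSq 1 (U s).1) fun s => ?_)
      · rw [lintegral_const_mul' _ _ (ENNReal.mul_ne_top hC enorm_ne_top)]
        exact ENNReal.mul_ne_top (ENNReal.mul_ne_top hC enorm_ne_top) hfin.ne
      · have h1 (k : Freq d) : ‖f k s‖ₑ ≤
            ‖coeff (U s).1 k.1‖ₑ * absTransport (smoothing γ₀ (U s).1) (U s).1 k.1 := by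
          rw [hfeq, coeff_coe]
          refine le_trans ?_ (mul_le_mul' le_rfl (enorm_transport_le _ _ k))
          rw [← ofReal_norm, ← ofReal_norm, ← ofReal_norm, ← ENNReal.ofReal_mul (norm_nonneg _)]
          exact ENNReal.ofReal_le_ofReal
            ((Complex.abs_re_le_norm _).trans (norm_inner_le_norm _ _))
        refine (ENNReal.tsum_le_tsum h1).trans ?_
        rw [tsum_freq (f := fun k => ‖coeff (U s).1 k‖ₑ *
          absTransport (smoothing γ₀ (U s).1) (U s).1 k) (by simp)]
        refine (hCb (U s)).trans (mul_le_mul' (mul_le_mul' le_rfl ?_) le_rfl)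
        rw [← ofReal_norm, ← ofReal_norm]
        exact ENNReal.ofReal_le_ofReal (u.norm_coe_le_norm _)
    have h2 := hasSum_integral_of_summable_integral_norm (μ := volume.restrict (Set.Ioc (0 : ℝ) t))
      (F := f) (fun k => ((hfc k).integrableOn_Icc (a := 0) (b := (t : ℝ))).mono_set
        Set.Ioc_subset_Icc_self) (by
        refine (ENNReal.summable_toReal hnorm).congr fun k => ?_
        rw [integral_norm_eq_lintegral_enorm (hfc k).aestronglyMeasurable])
    have h3 : ∫ s in Set.Ioc (0 : ℝ) t, ∑' k, f k s = 0 := by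
      refine integral_eq_zero_of_ae ?_
      filter_upwards [ae_lt_top (measurable_sobSq hUk 1) hfin.ne] with s hs
      simp only [hfeq]
      refine (hasSum_re_inner_transport (isDivFree_smoothing (hdiv s)) ((U s).2.2.smoothing γ₀)
        (ne_top_of_le_ne_top ?_ (hCb (U s)))).tsum_eq
      exact ENNReal.mul_ne_top (ENNReal.mul_ne_top hC enorm_ne_top) hs.ne
    rw [h3] at h2
    simpa only [intervalIntegral.integral_of_le ht0] using h2
  let X : Freq d → ℝ := fun k => ‖(u t).1 k‖ ^ 2 +
      2 * (ν * absFreq k.1 ^ 2) * ∫ s in (0 : ℝ)..t, ‖(U s).1 k‖ ^ 2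
  have hint0 (k : Freq d) : 0 ≤ ∫ s in (0 : ℝ)..t, ‖(U s).1 k‖ ^ 2 :=
    intervalIntegral.integral_nonneg ht0 fun s _ => sq_nonneg _
  have hX0 (k : Freq d) : 0 ≤ X k :=
    add_nonneg (sq_nonneg _) (mul_nonneg (by positivity) (hint0 k))
  have hu₀ : HasSum (fun k : Freq d => ‖u₀.1 k‖ ^ 2) (‖u₀‖ ^ 2) := by
    have h1 := u₀.2.1.summable (by norm_num)
    have h2 : Summable fun k : Freq d => ‖u₀.1 k‖ ^ 2 := by
      refine h1.congr fun k => ?_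
      simp [weighted]
    have h3 := Sobolev.norm_sq_eq 0 u₀
    simp only [mul_zero, Real.rpow_zero, one_mul] at h3
    rw [h3]
    exact h2.hasSum
  -- The full sum of the modewise balances equals `‖u₀‖²`, so nonnegativity of the terms bounds
  -- every partial sum.
  have hXsum (S : Finset (Freq d)) : ∑ k ∈ S, X k ≤ ‖u₀‖ ^ 2 := by
    have h1 := hu₀.sub (hsum.mul_left 2)
    rw [mul_zero, sub_zero] at h1
    exact sum_le_hasSum S (fun k _ => hX0 k) (h1.congr_fun hmode)
  have hXe (k : Freq d) : ENNReal.ofReal (X k) = (wt 0 k.1 * ‖(u t).1 k‖ₑ) ^ 2 +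
      ENNReal.ofReal (2 * ν) * ∫⁻ s in Set.Ioc (0 : ℝ) t, (wt 1 k.1 * ‖(U s).1 k‖ₑ) ^ 2 := by
    simp only [X]
    rw [ENNReal.ofReal_add (sq_nonneg _) (mul_nonneg (by positivity) (hint0 k)),
      wt_exponent_zero k.2, one_mul, ENNReal.ofReal_pow (norm_nonneg _), ofReal_norm]
    congr 1
    rw [show 2 * (ν * absFreq k.1 ^ 2) = 2 * ν * absFreq k.1 ^ 2 by ring, mul_assoc,
      ENNReal.ofReal_mul (p := 2 * ν) (by positivity)]
    congr 1
    have hc2 : Continuous fun s => ‖(U s).1 k‖ ^ 2 := (hUk' k).norm.pow 2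
    rw [ENNReal.ofReal_mul (sq_nonneg _), intervalIntegral.integral_of_le ht0, ofReal_integral_eq_lintegral_ofReal
      ((hc2.integrableOn_Icc (a := 0) (b := (t : ℝ))).mono_set Set.Ioc_subset_Icc_self)
      (Filter.Eventually.of_forall fun s => sq_nonneg _),
      ← lintegral_const_mul' _ _ ENNReal.ofReal_ne_top]
    refine lintegral_congr fun s => ?_
    rw [mul_pow, wt_of_ne _ k.2, Real.rpow_one, ENNReal.ofReal_pow (absFreq_nonneg _),
      ENNReal.ofReal_pow (norm_nonneg _), ofReal_norm]
  rw [Sobolev.enorm_sq_eq, sobSq_eq_freq]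
  simp only [sobSq_eq_freq 1]
  rw [lintegral_tsum fun k => (((hUk' k).enorm.measurable.const_mul _).pow_const 2).aemeasurable,
    ← ENNReal.tsum_mul_left, ← ENNReal.tsum_add]
  refine (tsum_congr fun k => (hXe k).symm).le.trans ?_
  rw [ENNReal.tsum_eq_iSup_sum]
  refine iSup_le fun S => ?_
  rw [← ENNReal.ofReal_sum_of_nonneg fun k _ => hX0 k, ← ofReal_norm,
    ← ENNReal.ofReal_pow (norm_nonneg _)]
  exact ENNReal.ofReal_le_ofReal (hXsum S)

/-! ### Smoothing by the heat semigroup -/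

theorem rpow_mul_exp_neg_le {q x : ℝ} (hq : 0 < q) (hx : 0 ≤ x) :
    x ^ q * Real.exp (-x) ≤ q ^ q := by
  have h1 : x / q ≤ Real.exp (x / q) := by linarith [Real.add_one_le_exp (x / q)]
  have h2 := Real.rpow_le_rpow (by positivity) h1 hq.le
  rw [← Real.exp_mul, div_mul_cancel₀ _ hq.ne', Real.div_rpow hx hq.le,
    div_le_iff₀ (by positivity)] at h2
  rw [Real.exp_neg, ← div_eq_mul_inv, div_le_iff₀ (Real.exp_pos x)]
  linarith

/-- Parabolic smoothing: gaining `p` derivatives costs `τ^{-p/2}`, because `x^{p/2} e^{-x}` is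
bounded and here `x = ντ|2πk|²`. -/
theorem exists_wt_mul_exp_le {ν p : ℝ} (hν : 0 < ν) (hp : 0 < p) :
    ∃ H : ENNReal, H ≠ ⊤ ∧ ∀ (τ : ℝ), 0 < τ → ∀ k : Fin d → ℤ,
      wt p k * ENNReal.ofReal (Real.exp (-(ν * τ * absFreq k ^ 2)))
        ≤ H * ENNReal.ofReal (τ ^ (-(p / 2))) := by
  refine ⟨ENNReal.ofReal ((p / 2) ^ (p / 2) * ν ^ (-(p / 2))), ENNReal.ofReal_ne_top,
    fun τ hτ k => ?_⟩
  rcases eq_or_ne k 0 with rfl | hk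
  · simp
  have hn := absFreq_pos_of_ne hk
  rw [wt_of_ne _ hk, ← ENNReal.ofReal_mul (by positivity), ← ENNReal.ofReal_mul (by positivity)]
  refine ENNReal.ofReal_le_ofReal ?_
  have h := rpow_mul_exp_neg_le (q := p / 2) (x := ν * τ * absFreq k ^ 2) (by positivity)
    (by positivity)
  have h2 : absFreq k ^ p = (ν * τ * absFreq k ^ 2) ^ (p / 2) * (ν ^ (-(p / 2)) * τ ^ (-(p / 2))) := by
    rw [Real.mul_rpow (by positivity) (by positivity), Real.mul_rpow hν.le hτ.le,
      Real.rpow_neg hν.le, Real.rpow_neg hτ.le, ← Real.rpow_natCast, ← Real.rpow_mul hn.le]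
    have := (Real.rpow_pos_of_pos hν (p / 2)).ne'
    have := (Real.rpow_pos_of_pos hτ (p / 2)).ne'
    field_simp
    norm_num
  rw [h2]
  calc _ = (ν * τ * absFreq k ^ 2) ^ (p / 2) * Real.exp (-(ν * τ * absFreq k ^ 2))
        * (ν ^ (-(p / 2)) * τ ^ (-(p / 2))) := by ring
    _ ≤ (p / 2) ^ (p / 2) * (ν ^ (-(p / 2)) * τ ^ (-(p / 2))) :=
        mul_le_mul_of_nonneg_right h (by positivity)
    _ = _ := by ring

/-- The linearized nonlinearity `Π[K(y)·∇u + K(u)·∇y]`. -/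
def linTerm (γ₀ : ℝ) (u y : FourierSeries d) : FourierSeries d :=
  leray (transport (smoothing γ₀ y) u + transport (smoothing γ₀ u) y)

theorem enorm_linTerm_le (γ₀ : ℝ) (u y : FourierSeries d) (k : Freq d) :
    ‖linTerm γ₀ u y k‖ₑ ≤ 2 * (absTransport (smoothing γ₀ y) u k.1
      + absTransport (smoothing γ₀ u) y k.1) :=
  (enorm_leray_le _ _).trans (mul_le_mul' le_rfl ((enorm_add_le _ _).trans
    (add_le_add (enorm_transport_le _ _ _) (enorm_transport_le _ _ _))))

theorem enorm_heat (κ t : ℝ) (u : FourierSeries d) (k : Freq d) :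
    ‖heat κ t u k‖ₑ =
      ENNReal.ofReal (Real.exp (-(viscConst d * κ * t * absFreq k.1 ^ 2))) * ‖u k‖ₑ := by
  rw [heat, enorm_smul, ← ofReal_norm (Real.exp _), Real.norm_of_nonneg (Real.exp_pos _).le]

theorem sq_add_sq_le_add_sq (a b : ENNReal) : a ^ 2 + b ^ 2 ≤ (a + b) ^ 2 := by
  rw [add_sq]
  exact add_le_add le_self_add le_rfl

/-- Smoothing estimate for the linearized nonlinearity. -/
theorem exists_sobSq_heat_linTerm_le {κ γ₀ β δ ε : ℝ} (hκ : 0 < viscConst d * κ) (hβ : 0 ≤ β)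
    (hβγ : β ≤ 2 * γ₀) (hδ : 0 < δ) (hεδ : ε ≤ δ) (hd : (d : ℝ) / 2 < δ - ε + 2 * γ₀) :
    ∃ c : ENNReal, c ≠ ⊤ ∧ ∀ τ : ℝ, 0 < τ → ∀ (u : Sobolev d 0) (y : Sobolev d (-β)),
      IsDivFree u.1 → sobSq (-β + ε) (heat κ τ (linTerm γ₀ u.1 y.1)) ≤
        (c * (ENNReal.ofReal (τ ^ (-(δ / 2))) * sobSq 1 u.1 ^ (1 / 2 : ℝ)
          + ENNReal.ofReal (τ ^ (-((1 + δ) / 2))) * ‖u‖ₑ) * ‖y‖ₑ) ^ 2 := by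
  -- The two products are measured with output exponents `-(β+δ-ε)` and `-(β+δ-ε+1)`. The gap to the
  -- target `-β+ε` is `δ`, respectively `1+δ`, which fixes the singular powers of `τ`. In both cases
  -- the weight available to the convolution bound is `δ-ε+2γ₀`.
  obtain ⟨C₁, hC₁, h₁⟩ := exists_absTransport_smoothing_le (d := d) (γ₀ := γ₀) (s := -β)
    (a := β + δ - ε) (by linarith) (by linarith) (by linarith)
  obtain ⟨C₂, hC₂, h₂⟩ := exists_absTransport_smoothing_le_of_isDivFree (d := d) (γ₀ := γ₀)
    (β := β) (r := β + δ - ε) hβ hβγ (by linarith) (by linarith)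
  obtain ⟨H₁, hH₁, hh₁⟩ := exists_wt_mul_exp_le (d := d) hκ hδ
  obtain ⟨H₂, hH₂, hh₂⟩ := exists_wt_mul_exp_le (d := d) (p := 1 + δ) hκ (by linarith)
  have hsq (C : ENNReal) : (C ^ (1 / 2 : ℝ)) ^ 2 = C := by
    rw [← ENNReal.rpow_natCast, ← ENNReal.rpow_mul]; norm_num
  set B : ENNReal := 8 * (H₁ ^ 2 * C₁ + H₂ ^ 2 * C₂)
  have hB : B ≠ ⊤ := ENNReal.mul_ne_top (by simp) (ENNReal.add_ne_top.2
    ⟨ENNReal.mul_ne_top (ENNReal.pow_ne_top hH₁) hC₁,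
      ENNReal.mul_ne_top (ENNReal.pow_ne_top hH₂) hC₂⟩)
  refine ⟨B ^ (1 / 2 : ℝ), ENNReal.rpow_ne_top_of_nonneg (by norm_num) hB, fun τ hτ u y hu => ?_⟩
  set t₁ := ENNReal.ofReal (τ ^ (-(δ / 2)))
  set t₂ := ENNReal.ofReal (τ ^ (-((1 + δ) / 2)))
  set b : (Fin d → ℤ) → ENNReal := absTransport (smoothing γ₀ y.1) u.1
  set a : (Fin d → ℤ) → ENNReal := absTransport (smoothing γ₀ u.1) y.1
  have hterm (k : Fin d → ℤ) :
      (wt (-β + ε) k * ‖coeff (heat κ τ (linTerm γ₀ u.1 y.1)) k‖ₑ) ^ 2 ≤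
      8 * ((H₁ * t₁) ^ 2 * (wt (-(β + δ - ε)) k * b k) ^ 2
        + (H₂ * t₂) ^ 2 * (wt (-(β + δ - ε + 1)) k * a k) ^ 2) := by
    rcases eq_or_ne k 0 with rfl | hk
    · simp
    have e : wt (-β + ε) k * ‖coeff (heat κ τ (linTerm γ₀ u.1 y.1)) k‖ₑ ≤
        2 * (H₁ * t₁ * (wt (-(β + δ - ε)) k * b k)
          + H₂ * t₂ * (wt (-(β + δ - ε + 1)) k * a k)) := by
      set E := ENNReal.ofReal (Real.exp (-(viscConst d * κ * τ * absFreq k ^ 2)))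
      calc wt (-β + ε) k * ‖coeff (heat κ τ (linTerm γ₀ u.1 y.1)) k‖ₑ
          ≤ wt (-β + ε) k * (E * (2 * (b k + a k))) := by
            rw [coeff_of_ne _ hk, enorm_heat]
            exact mul_le_mul' le_rfl (mul_le_mul' le_rfl (enorm_linTerm_le γ₀ u.1 y.1 ⟨k, hk⟩))
        _ = 2 * (wt δ k * E * (wt (-(β + δ - ε)) k * b k)
            + wt (1 + δ) k * E * (wt (-(β + δ - ε + 1)) k * a k)) := by
            have e1 : wt (-β + ε) k = wt δ k * wt (-(β + δ - ε)) k := by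
              rw [wt_mul]; congr 1; ring
            have e2 : wt (-β + ε) k = wt (1 + δ) k * wt (-(β + δ - ε + 1)) k := by
              rw [wt_mul]; congr 1; ring
            rw [show wt (-β + ε) k * (E * (2 * (b k + a k))) =
              2 * (wt (-β + ε) k * E * b k + wt (-β + ε) k * E * a k) by ring]
            nth_rw 1 [e1]
            rw [e2]
            ring
        _ ≤ _ := by
            exact mul_le_mul' le_rfl (add_le_add (mul_le_mul' (hh₁ τ hτ k) le_rfl)
              (mul_le_mul' (hh₂ τ hτ k) le_rfl))
    refine (pow_le_pow_left' e 2).trans ?_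
    rw [mul_pow]
    refine (mul_le_mul' le_rfl (add_sq_le _ _)).trans_eq ?_
    ring
  calc sobSq (-β + ε) (heat κ τ (linTerm γ₀ u.1 y.1))
      ≤ 8 * ((H₁ * t₁) ^ 2 * ∑' k, (wt (-(β + δ - ε)) k * b k) ^ 2
        + (H₂ * t₂) ^ 2 * ∑' k, (wt (-(β + δ - ε + 1)) k * a k) ^ 2) := by
        rw [← ENNReal.tsum_mul_left, ← ENNReal.tsum_mul_left, ← ENNReal.tsum_add,
          ← ENNReal.tsum_mul_left]
        exact ENNReal.tsum_le_tsum hterm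
    _ ≤ 8 * ((H₁ * t₁) ^ 2 * (C₁ * (‖y‖ₑ ^ 2 * sobSq 1 u.1))
        + (H₂ * t₂) ^ 2 * (C₂ * (‖u‖ₑ ^ 2 * ‖y‖ₑ ^ 2))) := by
        rw [Sobolev.enorm_sq_eq, Sobolev.enorm_sq_eq]
        gcongr
        · exact h₁ y.1 u.1
        · exact h₂ u.1 y.1 hu
    _ = (8 * (H₁ ^ 2 * C₁) * (t₁ * sobSq 1 u.1 ^ (1 / 2 : ℝ)) ^ 2
        + 8 * (H₂ ^ 2 * C₂) * (t₂ * ‖u‖ₑ) ^ 2) * ‖y‖ₑ ^ 2 := by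
        rw [mul_pow t₁, hsq]; ring
    _ ≤ (B * (t₁ * sobSq 1 u.1 ^ (1 / 2 : ℝ)) ^ 2 + B * (t₂ * ‖u‖ₑ) ^ 2) * ‖y‖ₑ ^ 2 := by
        gcongr
        · simp only [B, mul_add]; exact le_self_add
        · simp only [B, mul_add]; exact le_add_self
    _ ≤ _ := by
        rw [← mul_add, mul_pow (_ * _) ‖y‖ₑ, mul_pow (B ^ (1 / 2 : ℝ)), hsq]
        exact mul_le_mul' (mul_le_mul' le_rfl (sq_add_sq_le_add_sq _ _)) le_rfl

/-! ### Time integrals of the singular kernels -/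

/-- After the substitution `τ = t - s`, enlarging the domain to the half-line gives a Gamma
integral; the power of `l` is its scaling. -/
theorem lintegral_exp_mul_rpow_le {p l t : ℝ} (hp : p < 1) (hl : 0 < l) :
    ∫⁻ s in Set.Ioc 0 t, ENNReal.ofReal (Real.exp (-(l * (t - s))) * (t - s) ^ (-p)) ≤
      ENNReal.ofReal (Real.Gamma (1 - p) * l ^ (-(1 - p))) := by
  let f : ℝ → ENNReal := fun τ => ENNReal.ofReal (Real.exp (-(l * τ)) * τ ^ (-p))
  have hG : ∫ τ in Set.Ioi (0 : ℝ), Real.exp (-(l * τ)) * τ ^ (-p) =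
      Real.Gamma (1 - p) * l ^ (-(1 - p)) := by
    have h := Real.integral_rpow_mul_exp_neg_mul_Ioi (a := 1 - p) (r := l) (by linarith) hl
    rw [show 1 - p - 1 = -p by ring] at h
    rw [Real.rpow_neg hl.le, ← Real.inv_rpow hl.le, ← one_div, mul_comm (Real.Gamma _), ← h]
    exact integral_congr_ae (Filter.Eventually.of_forall fun τ => mul_comm _ _)
  -- A non-integrable function would have integral zero by convention, but the Gamma value is
  -- positive.
  have hint : IntegrableOn (fun τ => Real.exp (-(l * τ)) * τ ^ (-p)) (Set.Ioi 0) := by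
    by_contra hcon
    have h0 := integral_undef hcon
    rw [hG] at h0
    have h1 : 0 < Real.Gamma (1 - p) * l ^ (-(1 - p)) :=
      mul_pos (Real.Gamma_pos_of_pos (by linarith)) (Real.rpow_pos_of_pos hl _)
    exact h1.ne' h0
  have hpos : ∀ᵐ τ ∂volume.restrict (Set.Ioi (0 : ℝ)), 0 ≤ Real.exp (-(l * τ)) * τ ^ (-p) := by
    filter_upwards [ae_restrict_mem measurableSet_Ioi] with τ hτ
    exact mul_nonneg (Real.exp_pos _).le (Real.rpow_nonneg (le_of_lt hτ) _)
  calc ∫⁻ s in Set.Ioc 0 t, f (t - s) = ∫⁻ s in Set.Ioo 0 t, f (t - s) := by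
        rw [Measure.restrict_congr_set Ioo_ae_eq_Ioc]
    _ ≤ ∫⁻ s, (Set.Ioi (0 : ℝ)).indicator f (t - s) := by
        rw [← lintegral_indicator measurableSet_Ioo]
        refine lintegral_mono fun s => ?_
        by_cases hs : s ∈ Set.Ioo 0 t
        · have : t - s ∈ Set.Ioi (0 : ℝ) := by simpa using hs.2
          simp [hs, this]
        · simp [hs]
    _ = ∫⁻ τ in Set.Ioi (0 : ℝ), f τ := by
        rw [lintegral_sub_left_eq_self (fun τ => (Set.Ioi (0 : ℝ)).indicator f τ),
          lintegral_indicator measurableSet_Ioi]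
    _ = _ := by
        rw [← hG, ofReal_integral_eq_lintegral_ofReal hint hpos]

/-- Convolution of the weighted kernels with an `L²` and with a bounded function. -/
theorem exists_lintegral_kernel_le {δ : ℝ} (hδ' : δ < 1) :
    ∃ g : ENNReal, g ≠ ⊤ ∧ ∀ (l t : ℝ), 0 < l → ∀ (D : ℝ → ENNReal), Measurable D →
      ∀ R : ENNReal, R ≠ ⊤ →
      ∫⁻ s in Set.Ioc 0 t, (ENNReal.ofReal ((t - s) ^ (-(δ / 2))) * D s ^ (1 / 2 : ℝ)
        + ENNReal.ofReal ((t - s) ^ (-((1 + δ) / 2))) * R)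
          * ENNReal.ofReal (Real.exp (-(l * (t - s)))) ≤
        g * ENNReal.ofReal (l ^ (-((1 - δ) / 2))) *
          ((∫⁻ s in Set.Ioc 0 t, D s) ^ (1 / 2 : ℝ) + R) := by
  -- `g₁` comes from Cauchy–Schwarz: the squared kernel has singularity `δ` and rate `2l`, hence the
  -- power of `2`, and a square root is taken at the end. `g₂` is the plain integral with
  -- singularity `(1+δ)/2`. Both scale as `l^{-(1-δ)/2}`.
  set g₁ : ENNReal := ENNReal.ofReal (Real.Gamma (1 - δ) * 2 ^ (-(1 - δ))) ^ (1 / 2 : ℝ)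
  set g₂ : ENNReal := ENNReal.ofReal (Real.Gamma (1 - (1 + δ) / 2))
  have hg₁ : g₁ ≠ ⊤ := ENNReal.rpow_ne_top_of_nonneg (by norm_num) ENNReal.ofReal_ne_top
  have hg₂ : g₂ ≠ ⊤ := ENNReal.ofReal_ne_top
  have hsq (C : ENNReal) : (C ^ (1 / 2 : ℝ)) ^ 2 = C := by
    rw [← ENNReal.rpow_natCast, ← ENNReal.rpow_mul]; norm_num
  refine ⟨g₁ + g₂, ENNReal.add_ne_top.2 ⟨hg₁, hg₂⟩, fun l t hl D hD R hR => ?_⟩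
  set L : ENNReal := ENNReal.ofReal (l ^ (-((1 - δ) / 2)))
  have hm1 : Measurable fun s : ℝ => ENNReal.ofReal ((t - s) ^ (-(δ / 2)))
      * ENNReal.ofReal (Real.exp (-(l * (t - s)))) := by fun_prop
  have hm2 : Measurable fun s : ℝ => D s ^ (1 / 2 : ℝ) := hD.pow_const _
  have h1 : ∫⁻ s in Set.Ioc 0 t, (ENNReal.ofReal ((t - s) ^ (-(δ / 2)))
      * ENNReal.ofReal (Real.exp (-(l * (t - s))))) * D s ^ (1 / 2 : ℝ) ≤
      g₁ * L * (∫⁻ s in Set.Ioc 0 t, D s) ^ (1 / 2 : ℝ) := by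
    refine le_of_sq_le_sq ((lintegral_mul_sq_le hm1.aemeasurable hm2.aemeasurable).trans ?_)
    simp only [hsq, mul_pow (g₁ * L)]
    refine mul_le_mul' ?_ le_rfl
    have h2 := lintegral_exp_mul_rpow_le (p := δ) (l := 2 * l) (t := t) hδ' (by linarith)
    refine (le_of_eq (setLIntegral_congr_fun measurableSet_Ioc fun s hs => ?_)).trans
      (h2.trans_eq ?_)
    · have hts : 0 ≤ t - s := sub_nonneg.2 hs.2
      rw [← ENNReal.ofReal_mul (Real.rpow_nonneg hts _), ← ENNReal.ofReal_pow
        (mul_nonneg (Real.rpow_nonneg hts _) (Real.exp_pos _).le), mul_pow, ← Real.exp_nat_mul,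
        ← Real.rpow_natCast, ← Real.rpow_mul hts]
      rw [mul_comm]
      congr 2
      · congr 1; push_cast; ring
      · congr 1; push_cast; ring
    · simp only [g₁, L, mul_pow, hsq]
      rw [← ENNReal.ofReal_pow (Real.rpow_nonneg hl.le _), ← ENNReal.ofReal_mul
        (mul_nonneg (Real.Gamma_pos_of_pos (by linarith)).le (by positivity)),
        Real.mul_rpow (by norm_num) hl.le, ← Real.rpow_natCast (l ^ _), ← Real.rpow_mul hl.le]
      congr 1
      rw [mul_assoc]
      congr 3
      push_cast; ring
  have h3 : ∫⁻ s in Set.Ioc 0 t, (ENNReal.ofReal ((t - s) ^ (-((1 + δ) / 2)))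
      * ENNReal.ofReal (Real.exp (-(l * (t - s))))) * R ≤ g₂ * L * R := by
    rw [lintegral_mul_const' _ _ hR]
    refine mul_le_mul' ?_ le_rfl
    have h2 := lintegral_exp_mul_rpow_le (p := (1 + δ) / 2) (l := l) (t := t) (by linarith) hl
    refine (le_of_eq (setLIntegral_congr_fun measurableSet_Ioc fun s hs => ?_)).trans
      (h2.trans_eq ?_)
    · rw [mul_comm, ← ENNReal.ofReal_mul (Real.exp_pos _).le]
    · rw [ENNReal.ofReal_mul (Real.Gamma_pos_of_pos (by linarith)).le]
      simp only [g₂, L]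
      congr 4
      ring
  calc _ = ∫⁻ s in Set.Ioc 0 t, ((ENNReal.ofReal ((t - s) ^ (-(δ / 2)))
      * ENNReal.ofReal (Real.exp (-(l * (t - s))))) * D s ^ (1 / 2 : ℝ)
      + (ENNReal.ofReal ((t - s) ^ (-((1 + δ) / 2)))
      * ENNReal.ofReal (Real.exp (-(l * (t - s))))) * R) := by
        refine lintegral_congr fun s => ?_
        ring
    _ ≤ g₁ * L * (∫⁻ s in Set.Ioc 0 t, D s) ^ (1 / 2 : ℝ) + g₂ * L * R := by
        rw [lintegral_add_left (f := fun s => (ENNReal.ofReal ((t - s) ^ (-(δ / 2)))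
          * ENNReal.ofReal (Real.exp (-(l * (t - s))))) * D s ^ (1 / 2 : ℝ)) (hm1.mul hm2)]
        exact add_le_add h1 h3
    _ ≤ (g₁ + g₂) * L * (∫⁻ s in Set.Ioc 0 t, D s) ^ (1 / 2 : ℝ) + (g₁ + g₂) * L * R := by
        gcongr
        · exact le_self_add
        · exact le_add_self
    _ = _ := by ring

/-! ### A Volterra-type Neumann series -/

/-- `B` need not be a contraction in the given norm: geometric decay of its powers up to a constant
already makes the Neumann series converge. -/
theorem exists_inverse_one_sub {X : Type*} [NormedAddCommGroup X] [NormedSpace ℝ X]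
    [CompleteSpace X] {B : X →L[ℝ] X} {K : ℝ} (hB : ∀ n : ℕ, ‖B ^ n‖ ≤ (1 / 2) ^ n * K) :
    ∃ S : X →L[ℝ] X, (∀ y z, y = B y + z ↔ y = S z) ∧ ‖S‖ ≤ 2 * K := by
  have hgeom : HasSum (fun n : ℕ => (1 / 2 : ℝ) ^ n * K) (2 * K) := hasSum_geometric_two.mul_right _
  have hsum : Summable (fun n : ℕ => B ^ n) := Summable.of_norm_bounded hgeom.summable hB
  obtain ⟨S, hS⟩ : ∃ S, S = ∑' n : ℕ, B ^ n := ⟨_, rfl⟩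
  have h1 : S * (1 - B) = 1 := hS ▸ hsum.tsum_pow_mul_one_sub
  have h2 : (1 - B) * S = 1 := hS ▸ hsum.one_sub_mul_tsum_pow
  refine ⟨S, fun y z => ⟨fun hy => ?_, fun hy => ?_⟩, hS ▸ tsum_of_norm_bounded hgeom hB⟩
  · have hz : z = (1 - B) y := (sub_eq_of_eq_add' hy).symm
    rw [hz]
    exact (congrArg (fun L : X →L[ℝ] X => L y) h1).symm
  · have hz : y - B y = z := by
      rw [hy]
      exact congrArg (fun L : X →L[ℝ] X => L z) h2
    rw [← hz, add_sub_cancel]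

/-- If `A` contracts the norm `sup_t e^{-lt}‖y_t‖` by `1/2`, then `1 - A` is invertible, with a bound
of the inverse in the supremum norm. -/
theorem exists_solution_operator {E : Type*} [NormedAddCommGroup E] [NormedSpace ℝ E]
    [CompleteSpace E] {T l : ℝ} (hl : 0 ≤ l)
    (A : C(Set.Icc (0 : ℝ) T, E) →ₗ[ℝ] C(Set.Icc (0 : ℝ) T, E))
    (h : ∀ (y : C(Set.Icc (0 : ℝ) T, E)) (b : ℝ), 0 ≤ b → (∀ s, ‖y s‖ ≤ Real.exp (l * s) * b) →
      ∀ t, ‖A y t‖ ≤ 1 / 2 * (Real.exp (l * t) * b)) :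
    ∃ S : C(Set.Icc (0 : ℝ) T, E) →L[ℝ] C(Set.Icc (0 : ℝ) T, E),
      (∀ y z, y = A y + z ↔ y = S z) ∧ ‖S‖ ≤ 2 * Real.exp (l * T) := by
  have hexp (t : Set.Icc (0 : ℝ) T) : Real.exp (l * t) ≤ Real.exp (l * T) :=
    Real.exp_le_exp.2 (mul_le_mul_of_nonneg_left t.2.2 hl)
  have hone (y : C(Set.Icc (0 : ℝ) T, E)) (s : Set.Icc (0 : ℝ) T) :
      ‖y s‖ ≤ Real.exp (l * s) * ‖y‖ :=
    (y.norm_coe_le_norm s).trans (le_mul_of_one_le_left (norm_nonneg _)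
      (Real.one_le_exp (mul_nonneg hl s.2.1)))
  have hA (y : C(Set.Icc (0 : ℝ) T, E)) : ‖A y‖ ≤ 1 / 2 * Real.exp (l * T) * ‖y‖ := by
    refine (ContinuousMap.norm_le _ (by positivity)).2 fun t => ?_
    refine (h y ‖y‖ (norm_nonneg _) (hone y) t).trans ?_
    rw [mul_assoc]
    exact mul_le_mul_of_nonneg_left (mul_le_mul_of_nonneg_right (hexp t) (norm_nonneg _))
      (by norm_num)
  obtain ⟨B, hBA⟩ : ∃ B : C(Set.Icc (0 : ℝ) T, E) →L[ℝ] C(Set.Icc (0 : ℝ) T, E), ∀ y, B y = A y :=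
    ⟨A.mkContinuous _ hA, fun _ => rfl⟩
  -- The exponential weight is carried through all iterations and compared with the supremum norm
  -- only once, so the loss `e^{lT}` does not grow with `n`.
  have hpow (n : ℕ) (y : C(Set.Icc (0 : ℝ) T, E)) (t : Set.Icc (0 : ℝ) T) :
      ‖(B ^ n) y t‖ ≤ Real.exp (l * t) * ((1 / 2) ^ n * ‖y‖) := by
    induction n generalizing t with
    | zero => simpa using hone y t
    | succ n ih =>
      have h1 : (B ^ (n + 1)) y = A ((B ^ n) y) := by
        rw [pow_succ', mul_apply_eq_comp, hBA]
      rw [h1]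
      refine (h ((B ^ n) y) ((1 / 2) ^ n * ‖y‖) (by positivity) ih t).trans_eq ?_
      ring
  have hnorm (n : ℕ) : ‖B ^ n‖ ≤ (1 / 2) ^ n * Real.exp (l * T) := by
    refine ContinuousLinearMap.opNorm_le_bound _ (by positivity) fun y => ?_
    refine (ContinuousMap.norm_le _ (by positivity)).2 fun t => (hpow n y t).trans ?_
    calc Real.exp (l * t) * ((1 / 2) ^ n * ‖y‖) ≤ Real.exp (l * T) * ((1 / 2) ^ n * ‖y‖) :=
          mul_le_mul_of_nonneg_right (hexp t) (by positivity)
      _ = _ := by ring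
  obtain ⟨S, hS, hSn⟩ := exists_inverse_one_sub hnorm
  exact ⟨S, fun y z => by rw [← hBA]; exact hS y z, hSn⟩

/-! ### The linearized operator -/

theorem linTerm_add {γ₀ : ℝ} {u y y' : FourierSeries d} {k : Freq d}
    (h₁ : absTransport (smoothing γ₀ y) u k.1 ≠ ⊤) (h₁' : absTransport (smoothing γ₀ y') u k.1 ≠ ⊤)
    (h₂ : absTransport (smoothing γ₀ u) y k.1 ≠ ⊤)
    (h₂' : absTransport (smoothing γ₀ u) y' k.1 ≠ ⊤) :
    linTerm γ₀ u (y + y') k = linTerm γ₀ u y k + linTerm γ₀ u y' k := by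
  simp only [linTerm]
  refine (leray_eq_of_eq (v := (transport (smoothing γ₀ y) u + transport (smoothing γ₀ u) y)
    + (transport (smoothing γ₀ y') u + transport (smoothing γ₀ u) y')) ?_).trans ?_
  · change transport (smoothing γ₀ (y + y')) u k + transport (smoothing γ₀ u) (y + y') k =
      (transport (smoothing γ₀ y) u k + transport (smoothing γ₀ u) y k)
        + (transport (smoothing γ₀ y') u k + transport (smoothing γ₀ u) y' k)
    rw [smoothing_add, transport_add_left h₁ h₁', transport_add_right h₂ h₂']
    abel
  · rw [leray_add]
    rfl

theorem linTerm_smul (γ₀ c : ℝ) (u y : FourierSeries d) :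
    linTerm γ₀ u (c • y) = c • linTerm γ₀ u y := by
  simp only [linTerm]
  rw [smoothing_smul, transport_smul_left, transport_smul_right, ← smul_add, leray_smul]

theorem isReal_linTerm {γ₀ : ℝ} {u y : FourierSeries d} (hu : IsReal u) (hy : IsReal y) :
    IsReal (linTerm γ₀ u y) :=
  (((hy.smoothing γ₀).transport hu).add ((hu.smoothing γ₀).transport hy)).leray

/-- Only finiteness of each mode matters here, so the output regularity may be taken as negative as
convenient; `a = d/2 + 1` is such a choice. -/
theorem absTransport_smoothing_ne_top {γ₀ β : ℝ} (hβγ : β ≤ 2 * γ₀) {u : Sobolev d 0}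
    (hu : sobSq 1 u.1 ≠ ⊤) (y : Sobolev d (-β)) (k : Freq d) :
    absTransport (smoothing γ₀ y.1) u.1 k.1 ≠ ⊤ := by
  obtain ⟨C, hC, h⟩ := exists_absTransport_smoothing_le (d := d) (γ₀ := γ₀) (s := -β)
    (a := (d : ℝ) / 2 + 1) (by positivity) (by linarith) (by linarith)
  refine absTransport_ne_top_of_tsum (p := -((d : ℝ) / 2 + 1)) (ne_top_of_le_ne_top ?_ (h _ _)) k
  exact ENNReal.mul_ne_top hC (ENNReal.mul_ne_top (Sobolev.sobSq_lt_top y).ne hu)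

theorem absTransport_smoothing_ne_top_of_isDivFree {γ₀ β : ℝ} (hβ : 0 ≤ β) (hβγ : β ≤ 2 * γ₀)
    {u : Sobolev d 0} (hu : IsDivFree u.1) (y : Sobolev d (-β)) (k : Freq d) :
    absTransport (smoothing γ₀ u.1) y.1 k.1 ≠ ⊤ := by
  obtain ⟨C, hC, h⟩ := exists_absTransport_smoothing_le_of_isDivFree (d := d) (γ₀ := γ₀) (β := β)
    (r := β + (d : ℝ) / 2 + 1) hβ hβγ (by linarith [Nat.cast_nonneg (α := ℝ) d])
    (by linarith)
  refine absTransport_ne_top_of_tsum (p := -(β + (d : ℝ) / 2 + 1 + 1))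
    (ne_top_of_le_ne_top ?_ (h _ _ hu)) k
  exact ENNReal.mul_ne_top hC (ENNReal.mul_ne_top (Sobolev.sobSq_lt_top u).ne
    (Sobolev.sobSq_lt_top y).ne)

/-! ### Paths extended to the real line and measurability of the Duhamel integrand. -/

section Path

variable {T : ℝ} (hT : 0 ≤ T)

/-- The extension of a path on `[0,T]` to `ℝ` that is constant outside `[0,T]`. -/
def extPath {E : Type*} [TopologicalSpace E] (y : C(Set.Icc (0 : ℝ) T, E)) (s : ℝ) : E :=
  y (Set.projIcc 0 T hT s)

theorem continuous_extPath {E : Type*} [TopologicalSpace E] (y : C(Set.Icc (0 : ℝ) T, E)) :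
    Continuous (extPath hT y) := y.continuous.comp continuous_projIcc

theorem continuous_coeff_extPath {s : ℝ} (y : C(Set.Icc (0 : ℝ) T, Sobolev d s)) (k : Fin d → ℤ) :
    Continuous fun x => coeff (extPath hT y x).1 k :=
  (Sobolev.continuous_coeff k).comp (continuous_extPath hT y)

variable {κ γ₀ β : ℝ} (hβ : 0 ≤ β) (hβγ : β ≤ 2 * γ₀) {u : C(Set.Icc (0 : ℝ) T, Sobolev d 0)}
  (hu : ∀ t, IsDivFree (u t).1)
  (hD : ∫⁻ s in Set.Ioc 0 T, sobSq 1 (extPath hT u s).1 ≠ ⊤)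

include hD in
theorem ae_sobSq_extPath_ne_top :
    ∀ᵐ s ∂volume.restrict (Set.Ioc 0 T), sobSq 1 (extPath hT u s).1 ≠ ⊤ := by
  filter_upwards [ae_lt_top (measurable_sobSq (continuous_coeff_extPath hT u) 1) hD] with s hs
  exact hs.ne

include hβ hβγ hu hD in
theorem aestronglyMeasurable_linTerm (y : C(Set.Icc (0 : ℝ) T, Sobolev d (-β))) (k : Freq d) :
    AEStronglyMeasurable (fun s => linTerm γ₀ (extPath hT u s).1 (extPath hT y s).1 k)
      (volume.restrict (Set.Ioc 0 T)) := by
  simp only [linTerm, leray_apply]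
  refine (continuous_lerayMode k).comp_aestronglyMeasurable (AEStronglyMeasurable.add
    (aestronglyMeasurable_transport
      (continuous_coeff_smoothing (continuous_coeff_extPath hT y) γ₀)
      (continuous_coeff_extPath hT u) k ?_)
    (aestronglyMeasurable_transport
      (continuous_coeff_smoothing (continuous_coeff_extPath hT u) γ₀)
      (continuous_coeff_extPath hT y) k ?_))
  · filter_upwards [ae_sobSq_extPath_ne_top hT hD] with s hs
    exact absTransport_smoothing_ne_top hβγ hs _ k
  · exact Filter.Eventually.of_forall fun s =>
      absTransport_smoothing_ne_top_of_isDivFree hβ hβγ (hu _) _ k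

include hβ hβγ hu hD in
theorem aestronglyMeasurable_heat_linTerm (y : C(Set.Icc (0 : ℝ) T, Sobolev d (-β))) (k : Freq d)
    {t : ℝ} (ht : t ≤ T) : AEStronglyMeasurable
      (fun s => heat κ (t - s) (linTerm γ₀ (extPath hT u s).1 (extPath hT y s).1) k)
      (volume.restrict (Set.Ioc 0 t)) := by
  have h := (aestronglyMeasurable_linTerm hT hβ hβγ hu hD y k).mono_measure
    (Measure.restrict_mono (Set.Ioc_subset_Ioc_right ht) le_rfl)
  have h2 : Continuous fun s => Real.exp (-(viscConst d * κ * (t - s) * absFreq k.1 ^ 2)) := by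
    fun_prop
  exact h2.aestronglyMeasurable.smul h

end Path

/-- The basic estimate for the Duhamel integral of the linearized nonlinearity, with exponential
weights in time. -/
theorem exists_tsum_lintegral_heat_linTerm_le {κ γ₀ β δ ε : ℝ} (hκ : 0 < viscConst d * κ)
    (hβ : 0 ≤ β) (hβγ : β ≤ 2 * γ₀) (hδ : 0 < δ) (hδ' : δ < 1) (hεδ : ε ≤ δ)
    (hd : (d : ℝ) / 2 < δ - ε + 2 * γ₀) :
    ∃ C : ENNReal, C ≠ ⊤ ∧ ∀ (T : ℝ) (hT : 0 ≤ T) (u : C(Set.Icc (0 : ℝ) T, Sobolev d 0)),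
      (∀ t, IsDivFree (u t).1) → ∫⁻ s in Set.Ioc 0 T, sobSq 1 (extPath hT u s).1 ≠ ⊤ →
      ∀ R : ENNReal, R ≠ ⊤ → (∀ t, ‖u t‖ₑ ≤ R) →
      ∀ (y : C(Set.Icc (0 : ℝ) T, Sobolev d (-β))) (l : ℝ), 0 < l → ∀ b : ENNReal, b ≠ ⊤ →
      (∀ s : Set.Icc (0 : ℝ) T, ‖y s‖ₑ ≤ ENNReal.ofReal (Real.exp (l * s)) * b) →
      ∀ t : Set.Icc (0 : ℝ) T,
      ∑' k : Freq d, (∫⁻ s in Set.Ioc (0 : ℝ) t, wt (-β + ε) k.1 *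
        ‖heat κ (t - s) (linTerm γ₀ (extPath hT u s).1 (extPath hT y s).1) k‖ₑ) ^ 2 ≤
      (C * ENNReal.ofReal (l ^ (-((1 - δ) / 2))) *
        ((∫⁻ s in Set.Ioc 0 T, sobSq 1 (extPath hT u s).1) ^ (1 / 2 : ℝ) + R) *
        (ENNReal.ofReal (Real.exp (l * t)) * b)) ^ 2 := by
  obtain ⟨c, hc, hcb⟩ := exists_sobSq_heat_linTerm_le (d := d) hκ hβ hβγ hδ hεδ hd
  obtain ⟨g, hg, hgb⟩ := exists_lintegral_kernel_le hδ'
  refine ⟨c * g, ENNReal.mul_ne_top hc hg, fun T hT u hu hD R hR hRu y l hl b hb hy t => ?_⟩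
  set G : ℝ → ENNReal := fun s => c * (ENNReal.ofReal (Real.exp (l * t)) * b) *
    ((ENNReal.ofReal ((t - s) ^ (-(δ / 2))) * sobSq 1 (extPath hT u s).1 ^ (1 / 2 : ℝ)
        + ENNReal.ofReal ((t - s) ^ (-((1 + δ) / 2))) * R)
          * ENNReal.ofReal (Real.exp (-(l * (t - s)))))
  have hpt : ∀ s ∈ Set.Ioo (0 : ℝ) t, ∑' k : Freq d, (wt (-β + ε) k.1 *
      ‖heat κ (t - s) (linTerm γ₀ (extPath hT u s).1 (extPath hT y s).1) k‖ₑ) ^ 2 ≤ G s ^ 2 := by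
    intro s hs
    rw [← sobSq_eq_freq]
    refine (hcb (t - s) (by linarith [hs.2]) (extPath hT u s) (extPath hT y s) (hu _)).trans
      (pow_le_pow_left' ?_ 2)
    have hsT : s ∈ Set.Icc 0 T := ⟨hs.1.le, hs.2.le.trans t.2.2⟩
    -- Writing `e^{ls} = e^{lt} e^{-l(t-s)}` turns the growth allowed for `y` into damping of the
    -- kernel, the source of the negative power of `l`.
    have h1 : ‖extPath hT y s‖ₑ ≤ ENNReal.ofReal (Real.exp (l * t)) *
        ENNReal.ofReal (Real.exp (-(l * (t - s)))) * b := by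
      rw [← ENNReal.ofReal_mul (Real.exp_pos _).le, ← Real.exp_add,
        show l * t + -(l * (t - s)) = l * s by ring]
      have h2 := hy ⟨s, hsT⟩
      rwa [extPath, Set.projIcc_of_mem hT hsT]
    calc _ ≤ c * (ENNReal.ofReal ((t - s) ^ (-(δ / 2))) * sobSq 1 (extPath hT u s).1 ^ (1 / 2 : ℝ)
        + ENNReal.ofReal ((t - s) ^ (-((1 + δ) / 2))) * R) *
        (ENNReal.ofReal (Real.exp (l * t)) * ENNReal.ofReal (Real.exp (-(l * (t - s)))) * b) :=
          mul_le_mul' (mul_le_mul' le_rfl (add_le_add le_rfl (mul_le_mul' le_rfl (hRu _)))) h1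
      _ = G s := by simp only [G]; ring
  have hae : ∀ᵐ s ∂volume.restrict (Set.Ioc (0 : ℝ) t), ∑' k : Freq d, (wt (-β + ε) k.1 *
      ‖heat κ (t - s) (linTerm γ₀ (extPath hT u s).1 (extPath hT y s).1) k‖ₑ) ^ 2 ≤ G s ^ 2 := by
    -- The endpoint `s = t` is discarded since the smoothing estimate needs `t - s > 0`.
    rw [← Measure.restrict_congr_set (Ioo_ae_eq_Ioc (a := (0 : ℝ)) (b := t))]
    filter_upwards [ae_restrict_mem measurableSet_Ioo] with s hs
    exact hpt s hs
  refine (tsum_lintegral_sq_le (fun k => (aestronglyMeasurable_heat_linTerm hT hβ hβγ hu hD y k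
    t.2.2).enorm.const_mul _) hae).trans (pow_le_pow_left' ?_ 2)
  have hct : c * (ENNReal.ofReal (Real.exp (l * t)) * b) ≠ ⊤ :=
    ENNReal.mul_ne_top hc (ENNReal.mul_ne_top ENNReal.ofReal_ne_top hb)
  simp only [G]
  rw [lintegral_const_mul' _ _ hct]
  calc _ ≤ c * (ENNReal.ofReal (Real.exp (l * t)) * b) *
        (g * ENNReal.ofReal (l ^ (-((1 - δ) / 2))) *
          ((∫⁻ s in Set.Ioc 0 T, sobSq 1 (extPath hT u s).1) ^ (1 / 2 : ℝ) + R)) := by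
        refine mul_le_mul' le_rfl ((hgb l t hl _
          (measurable_sobSq (continuous_coeff_extPath hT u) 1) R hR).trans ?_)
        refine mul_le_mul' le_rfl (add_le_add (ENNReal.rpow_le_rpow ?_ (by norm_num)) le_rfl)
        exact lintegral_mono_set (Set.Ioc_subset_Ioc_right t.2.2)
    _ = _ := by ring

/-- The linear part `y ↦ -∫₀ᵗ P_{t-s} Π[K(y_s)·∇u_s + K(u_s)·∇y_s] ds` of the equation, as a linear
map on `C([0,T]; H^{-β})`. -/
theorem exists_linearized_operator {κ γ₀ β δ ε : ℝ} (hκ : 0 < viscConst d * κ)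
    (hβ : 0 ≤ β) (hβγ : β ≤ 2 * γ₀) (hδ : 0 < δ) (hδ' : δ < 1) (hε : 0 < ε) (hεδ : ε ≤ δ)
    (hd : (d : ℝ) / 2 < δ - ε + 2 * γ₀) :
    ∃ C : ENNReal, C ≠ ⊤ ∧ ∀ (T : ℝ) (hT : 0 ≤ T) (u : C(Set.Icc (0 : ℝ) T, Sobolev d 0)),
      (∀ t, IsDivFree (u t).1) → ∫⁻ s in Set.Ioc 0 T, sobSq 1 (extPath hT u s).1 ≠ ⊤ →
      ∀ R : ENNReal, R ≠ ⊤ → (∀ t, ‖u t‖ₑ ≤ R) →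
      ∃ A : C(Set.Icc (0 : ℝ) T, Sobolev d (-β)) →ₗ[ℝ] C(Set.Icc (0 : ℝ) T, Sobolev d (-β)),
        (∀ y (t : Set.Icc (0 : ℝ) T) (k : Freq d), IntervalIntegrable
          (fun s => heat κ (t - s) (linTerm γ₀ (extPath hT u s).1 (extPath hT y s).1) k)
            volume 0 t ∧
          (A y t).1 k = -∫ s in (0 : ℝ)..t,
            heat κ (t - s) (linTerm γ₀ (extPath hT u s).1 (extPath hT y s).1) k) ∧
        ∀ y (l : ℝ), 0 < l → ∀ b : ENNReal, b ≠ ⊤ →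
          (∀ s : Set.Icc (0 : ℝ) T, ‖y s‖ₑ ≤ ENNReal.ofReal (Real.exp (l * s)) * b) →
          ∀ t : Set.Icc (0 : ℝ) T,
          ‖A y t‖ₑ ≤ C * ENNReal.ofReal (l ^ (-((1 - δ) / 2))) *
            ((∫⁻ s in Set.Ioc 0 T, sobSq 1 (extPath hT u s).1) ^ (1 / 2 : ℝ) + R) *
            (ENNReal.ofReal (Real.exp (l * t)) * b) := by
  obtain ⟨C, hC, hCb⟩ := exists_tsum_lintegral_heat_linTerm_le (d := d) hκ hβ hβγ hδ hδ' hεδ hd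
  refine ⟨C, hC, fun T hT u hu hD R hR hRu => ?_⟩
  specialize hCb T hT u hu hD R hR hRu
  set I : ENNReal := (∫⁻ s in Set.Ioc 0 T, sobSq 1 (extPath hT u s).1) ^ (1 / 2 : ℝ) + R
  have hI : I ≠ ⊤ := ENNReal.add_ne_top.2
    ⟨ENNReal.rpow_ne_top_of_nonneg (by norm_num) hD, hR⟩
  let G : C(Set.Icc (0 : ℝ) T, Sobolev d (-β)) → ℝ → FourierSeries d :=
    fun y s => linTerm γ₀ (extPath hT u s).1 (extPath hT y s).1
  -- The rate `l = 1` is arbitrary here: it gives finiteness and a bound uniform in `t`, before any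
  -- rate is tuned for contraction.
  have hone (y : C(Set.Icc (0 : ℝ) T, Sobolev d (-β))) (s : Set.Icc (0 : ℝ) T) :
      ‖y s‖ₑ ≤ ENNReal.ofReal (Real.exp (1 * s)) * ‖y‖ₑ := by
    rw [← ofReal_norm, ← ofReal_norm, ← ENNReal.ofReal_mul (Real.exp_pos _).le]
    exact ENNReal.ofReal_le_ofReal ((y.norm_coe_le_norm s).trans
      (le_mul_of_one_le_left (norm_nonneg _) (Real.one_le_exp (by linarith [s.2.1]))))
  have hfin (y) (t : Set.Icc (0 : ℝ) T) (k : Freq d) :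
      ∫⁻ s in Set.Ioc (0 : ℝ) t, ‖heat κ (t - s) (G y s) k‖ₑ ≠ ⊤ := by
    have h1 := hCb y 1 one_pos ‖y‖ₑ enorm_ne_top (hone y) t
    have h2 := (ENNReal.le_tsum k).trans h1
    rw [lintegral_const_mul' _ _ (wt_ne_top _ _)] at h2
    have h3 := le_of_sq_le_sq h2
    intro htop
    simp only [G] at htop
    rw [htop, ENNReal.mul_top (wt_ne_zero _ k.2), top_le_iff] at h3
    revert h3
    exact ENNReal.mul_ne_top (ENNReal.mul_ne_top (ENNReal.mul_ne_top hC ENNReal.ofReal_ne_top) hI)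
      (ENNReal.mul_ne_top ENNReal.ofReal_ne_top enorm_ne_top)
  have hint (y) (t : Set.Icc (0 : ℝ) T) (k : Freq d) :
      IntervalIntegrable (fun s => heat κ (t - s) (G y s) k) volume 0 t := by
    rw [intervalIntegrable_iff_integrableOn_Ioc_of_le t.2.1]
    exact ⟨aestronglyMeasurable_heat_linTerm hT hβ hβγ hu hD y k t.2.2, (hfin y t k).lt_top⟩
  have hsob (y) (l : ℝ) (hl : 0 < l) (b : ENNReal) (hb : b ≠ ⊤)
      (hy : ∀ s : Set.Icc (0 : ℝ) T, ‖y s‖ₑ ≤ ENNReal.ofReal (Real.exp (l * s)) * b) (t : Set.Icc (0 : ℝ) T) :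
      sobSq (-β + ε) (duhamel κ t (G y)) ≤ (C * ENNReal.ofReal (l ^ (-((1 - δ) / 2))) * I *
        (ENNReal.ofReal (Real.exp (l * t)) * b)) ^ 2 := by
    refine le_trans ?_ (hCb y l hl b hb hy t)
    rw [sobSq_eq_freq]
    refine ENNReal.tsum_le_tsum fun k => pow_le_pow_left' ?_ 2
    rw [lintegral_const_mul' _ _ (wt_ne_top _ _), duhamel, intervalIntegral.integral_of_le t.2.1]
    exact mul_le_mul' le_rfl (enorm_integral_le_lintegral_enorm _)
  have hreal (y) (t : Set.Icc (0 : ℝ) T) : IsReal (duhamel κ t (G y)) :=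
    isReal_duhamel (fun s => isReal_linTerm (extPath hT u s).2.2 (extPath hT y s).2.2) κ t
  have hbdd (y : C(Set.Icc (0 : ℝ) T, Sobolev d (-β))) (t : Set.Icc (0 : ℝ) T) :
      sobSq (-β + ε) (duhamel κ t (G y)) ≤ (C * ENNReal.ofReal (1 ^ (-((1 - δ) / 2))) * I *
        (ENNReal.ofReal (Real.exp (1 * T)) * ‖y‖ₑ)) ^ 2 := by
    refine (hsob y 1 one_pos ‖y‖ₑ enorm_ne_top (hone y) t).trans ?_
    gcongr
    exact t.2.2
  have hbt (y : C(Set.Icc (0 : ℝ) T, Sobolev d (-β))) :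
      (C * ENNReal.ofReal (1 ^ (-((1 - δ) / 2))) * I *
        (ENNReal.ofReal (Real.exp (1 * T)) * ‖y‖ₑ)) ^ 2 ≠ ⊤ :=
    ENNReal.pow_ne_top (ENNReal.mul_ne_top (ENNReal.mul_ne_top
      (ENNReal.mul_ne_top hC ENNReal.ofReal_ne_top) hI)
      (ENNReal.mul_ne_top ENNReal.ofReal_ne_top enorm_ne_top))
  have hmem (y) (t : Set.Icc (0 : ℝ) T) : duhamel κ t (G y) ∈ Sobolev d (-β) :=
    Sobolev.mk_mem (((sobSq_mono (by linarith) _).trans (hbdd y t)).trans_lt (hbt y).lt_top)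
      (hreal y t)
  have hcont (y : C(Set.Icc (0 : ℝ) T, Sobolev d (-β))) : Continuous
      fun t : Set.Icc (0 : ℝ) T => (⟨duhamel κ t (G y), hmem y t⟩ : Sobolev d (-β)) := by
    -- The uniform bound with `ε` more derivatives reduces continuity to single modes. There,
    -- pulling `e^{-at}` out of the integral leaves the primitive of a fixed integrable function.
    refine continuous_of_sobSq_bounded (s' := -β + ε) (by linarith) (hbt y) (hbdd y) fun k => ?_
    set a := viscConst d * κ * absFreq k.1 ^ 2
    have hGint : IntegrableOn (fun s => Real.exp (a * s) • G y s k) (Set.uIcc 0 T) := by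
      have h1 := hint y ⟨T, hT, le_rfl⟩ k
      have h2 := h1.smul (Real.exp (a * T))
      rw [Set.uIcc_of_le hT, integrableOn_Icc_iff_integrableOn_Ioc,
        ← intervalIntegrable_iff_integrableOn_Ioc_of_le hT]
      refine h2.congr fun s _ => ?_
      simp only [Pi.smul_apply, heat, smul_smul, ← Real.exp_add]
      congr 2
      simp only [a]; ring
    have h3 := intervalIntegral.continuousOn_primitive_interval hGint
    rw [Set.uIcc_of_le hT, continuousOn_iff_continuous_domRestrict] at h3
    have h4 : Continuous fun t : Set.Icc (0 : ℝ) T => Real.exp (-(a * t)) := by fun_prop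
    refine (h4.smul h3).congr fun t => ?_
    change Real.exp (-(a * t)) • ∫ s in (0 : ℝ)..t, Real.exp (a * s) • G y s k = duhamel κ t (G y) k
    rw [duhamel, ← intervalIntegral.integral_smul]
    refine intervalIntegral.integral_congr fun s _ => ?_
    simp only [heat, smul_smul, ← Real.exp_add]
    congr 2
    simp only [a]; ring
  have hadd (y y') (t : Set.Icc (0 : ℝ) T) :
      duhamel κ t (G (y + y')) = duhamel κ t (G y) + duhamel κ t (G y') := by
    funext k
    change _ = duhamel κ t (G y) k + duhamel κ t (G y') k
    simp only [duhamel]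
    rw [← intervalIntegral.integral_add (hint y t k) (hint y' t k),
      intervalIntegral.integral_of_le t.2.1, intervalIntegral.integral_of_le t.2.1]
    refine integral_congr_ae ?_
    -- Additivity of the infinite sums defining the transport terms is available at those times
    -- where `u` has finite `H¹` norm, that is, almost everywhere.
    filter_upwards [ae_restrict_of_ae_restrict_of_subset (Set.Ioc_subset_Ioc_right t.2.2)
      (ae_sobSq_extPath_ne_top hT hD)] with s hs
    have h1 : G (y + y') s k = G y s k + G y' s k := linTerm_add
      (absTransport_smoothing_ne_top hβγ hs _ k) (absTransport_smoothing_ne_top hβγ hs _ k)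
      (absTransport_smoothing_ne_top_of_isDivFree hβ hβγ (hu _) _ k)
      (absTransport_smoothing_ne_top_of_isDivFree hβ hβγ (hu _) _ k)
    simp only [heat, h1, smul_add]
  have hsmul (c : ℝ) (y) (t : Set.Icc (0 : ℝ) T) :
      duhamel κ t (G (c • y)) = c • duhamel κ t (G y) := by
    funext k
    change _ = c • duhamel κ t (G y) k
    simp only [duhamel]
    rw [← intervalIntegral.integral_smul]
    refine intervalIntegral.integral_congr fun s _ => ?_
    have h1 : G (c • y) s = c • G y s := linTerm_smul _ _ _ _
    simp only [h1, heat_smul]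
    rfl
  let A : C(Set.Icc (0 : ℝ) T, Sobolev d (-β)) →ₗ[ℝ] C(Set.Icc (0 : ℝ) T, Sobolev d (-β)) :=
    { toFun := fun y => ⟨fun t => -⟨duhamel κ t (G y), hmem y t⟩, (hcont y).neg⟩
      map_add' := fun y y' => by
        ext1 t
        refine Subtype.ext ?_
        change -duhamel κ t (G (y + y')) = -duhamel κ t (G y) + -duhamel κ t (G y')
        rw [hadd, neg_add]
      map_smul' := fun c y => by
        ext1 t
        refine Subtype.ext ?_
        change -duhamel κ t (G (c • y)) = c • -duhamel κ t (G y)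
        rw [hsmul, smul_neg] }
  refine ⟨A, fun y t k => ⟨hint y t k, rfl⟩, fun y l hl b hb hy t => ?_⟩
  have h1 : ‖A y t‖ₑ = ‖(⟨duhamel κ t (G y), hmem y t⟩ : Sobolev d (-β))‖ₑ := enorm_neg _
  rw [h1]
  refine le_of_sq_le_sq ?_
  rw [Sobolev.enorm_sq_eq]
  exact (sobSq_mono (by linarith) _).trans (hsob y l hl b hb hy t)

/-! ### Well-posedness of the linearized equation. -/

theorem isLinearizedSolution_iff {κ γ₀ β T : ℝ} {hT : 0 ≤ T}
    {u : C(Set.Icc (0 : ℝ) T, Sobolev d 0)}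
    {A : C(Set.Icc (0 : ℝ) T, Sobolev d (-β)) →ₗ[ℝ] C(Set.Icc (0 : ℝ) T, Sobolev d (-β))}
    (hA : ∀ y (t : Set.Icc (0 : ℝ) T) (k : Freq d), IntervalIntegrable
      (fun s => heat κ (t - s) (linTerm γ₀ (extPath hT u s).1 (extPath hT y s).1) k) volume 0 t ∧
      (A y t).1 k = -∫ s in (0 : ℝ)..t,
        heat κ (t - s) (linTerm γ₀ (extPath hT u s).1 (extPath hT y s).1) k)
    (z y : C(Set.Icc (0 : ℝ) T, Sobolev d (-β))) :
    IsLinearizedSolution κ γ₀ β T hT u z y ↔ y = A y + z := by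
  have hval (t : Set.Icc (0 : ℝ) T) (k : Freq d) : ((A y + z) t).1 k = (z t).1 k -
      ∫ s in (0 : ℝ)..t,
        heat κ (t - s) (linTerm γ₀ (extPath hT u s).1 (extPath hT y s).1) k := by
    change (A y t).1 k + (z t).1 k = _
    rw [(hA y t k).2]
    abel
  constructor
  · intro h
    ext1 t
    refine Subtype.ext (funext fun k => ?_)
    exact (h t k).2.trans (hval t k).symm
  · intro h t k
    refine ⟨(hA y t k).1, ?_⟩
    exact (congrArg (fun w : C(Set.Icc (0 : ℝ) T, Sobolev d (-β)) => (w t).1 k) h).trans (hval t k)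

theorem lintegral_sobSq_rpow_le {κ γ₀ T : ℝ} {hT : 0 ≤ T} {u₀ : Sobolev d 0}
    {u : C(Set.Icc (0 : ℝ) T, Sobolev d 0)} (h : IsLerayAlphaSolution κ γ₀ T hT u₀ u)
    (hκ : 0 < viscConst d * κ) (hγ₀ : 0 ≤ γ₀) (hd : (d : ℝ) / 2 < 2 * γ₀ + 1) :
    (∫⁻ s in Set.Ioc 0 T, sobSq 1 (extPath hT u s).1) ^ (1 / 2 : ℝ) ≤
      (ENNReal.ofReal (2 * (viscConst d * κ)))⁻¹ ^ (1 / 2 : ℝ) * ‖u₀‖ₑ := by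
  have h1 := le_add_self.trans (h.energy_le hκ.le hγ₀ hd ⟨T, hT, le_rfl⟩)
  have h0 : ENNReal.ofReal (2 * (viscConst d * κ)) ≠ 0 :=
    (ENNReal.ofReal_pos.2 (by positivity)).ne'
  have h2 : ∫⁻ s in Set.Ioc 0 T, sobSq 1 (extPath hT u s).1 ≤
      (ENNReal.ofReal (2 * (viscConst d * κ)))⁻¹ * ‖u₀‖ₑ ^ 2 := by
    rw [mul_comm, ← div_eq_mul_inv, ENNReal.le_div_iff_mul_le (Or.inl h0)
      (Or.inl ENNReal.ofReal_ne_top), mul_comm]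
    exact h1
  refine (ENNReal.rpow_le_rpow h2 (by norm_num)).trans_eq ?_
  rw [ENNReal.mul_rpow_of_nonneg _ _ (by norm_num), ← ENNReal.rpow_natCast, ← ENNReal.rpow_mul]
  norm_num

/-- The exponential growth rate `(2CR)^q + 1/T` makes the linearized operator a contraction. -/
theorem mul_rpow_growth_rate_le {C R q T : ℝ} (hC : 0 < C) (hR : 0 ≤ R) (hq : 0 < q) (hT : 0 < T) :
    C * R * ((2 * C * R) ^ q + 1 / T) ^ (-(1 / q)) ≤ 1 / 2 := by
  rcases hR.eq_or_lt with rfl | hR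
  · simp
  have h1 : ((2 * C * R) ^ q + 1 / T) ^ (-(1 / q)) ≤ ((2 * C * R) ^ q) ^ (-(1 / q)) :=
    Real.rpow_le_rpow_of_nonpos (by positivity) (by simp [hT.le])
      (by rw [neg_nonpos]; positivity)
  have h2 : ((2 * C * R) ^ q) ^ (-(1 / q)) = (2 * C * R)⁻¹ := by
    rw [← Real.rpow_mul (by positivity), mul_neg, mul_one_div_cancel hq.ne', Real.rpow_neg_one]
  rw [h2] at h1
  calc _ ≤ C * R * (2 * C * R)⁻¹ := mul_le_mul_of_nonneg_left h1 (by positivity)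
    _ = 1 / 2 := by field_simp

/-- Well-posedness of the linearized equation, with a solution operator of norm at most
`2e · exp((2CR)^q T)`, where `R = ‖u₀‖` and `q = 2/(1-δ)`. -/
theorem exists_linearized_solution_operator {κ γ₀ β δ ε : ℝ} (hκ : 0 < viscConst d * κ)
    (hβ : 0 ≤ β) (hβγ : β ≤ 2 * γ₀) (hδ : 0 < δ) (hδ' : δ < 1) (hε : 0 < ε) (hεδ : ε ≤ δ)
    (hd : (d : ℝ) / 2 < δ - ε + 2 * γ₀) :
    ∃ C : ℝ, 0 < C ∧ ∀ (T : ℝ) (hT : 0 < T) (u₀ : Sobolev d 0)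
      (u : C(Set.Icc (0 : ℝ) T, Sobolev d 0)), IsLerayAlphaSolution κ γ₀ T hT.le u₀ u →
      ∃ S : C(Set.Icc (0 : ℝ) T, Sobolev d (-β)) →L[ℝ] C(Set.Icc (0 : ℝ) T, Sobolev d (-β)),
        (∀ z y, IsLinearizedSolution κ γ₀ β T hT.le u z y ↔ y = S z) ∧
        ‖S‖ ≤ 2 * Real.exp (((2 * C * ‖u₀‖) ^ (2 / (1 - δ)) + 1 / T) * T) := by
  obtain ⟨C, hC, hCb⟩ := exists_linearized_operator (d := d) hκ hβ hβγ hδ hδ' hε hεδ hd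
  set e := (ENNReal.ofReal (2 * (viscConst d * κ)))⁻¹ ^ (1 / 2 : ℝ)
  have he : e ≠ ⊤ := ENNReal.rpow_ne_top_of_nonneg (by norm_num)
    (ENNReal.inv_ne_top.2 (ENNReal.ofReal_pos.2 (by positivity)).ne')
  have hCe : C * (e + 1) ≠ ⊤ := ENNReal.mul_ne_top hC (by simp [he])
  -- `e‖u₀‖` bounds the `L²H¹` norm of `u` and `‖u₀‖` its `L^∞L²` norm, hence the factor `e + 1`;
  -- the last `1` makes the constant positive.
  set C₁ : ℝ := (C * (e + 1)).toReal + 1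
  have hC₁ : 0 < C₁ := add_pos_of_nonneg_of_pos ENNReal.toReal_nonneg one_pos
  refine ⟨C₁, hC₁, fun T hT u₀ u hu => ?_⟩
  have hγ₀ : 0 ≤ γ₀ := by linarith
  have hd' : (d : ℝ) / 2 < 2 * γ₀ + 1 := by linarith
  have hI := lintegral_sobSq_rpow_le hu hκ hγ₀ hd'
  have hD : ∫⁻ s in Set.Ioc 0 T, sobSq 1 (extPath hT.le u s).1 ≠ ⊤ := by
    intro htop
    rw [htop, ENNReal.top_rpow_of_pos (by norm_num), top_le_iff] at hI
    exact ENNReal.mul_ne_top he enorm_ne_top hI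
  have hR (t : Set.Icc (0 : ℝ) T) : ‖u t‖ₑ ≤ ‖u₀‖ₑ :=
    le_of_sq_le_sq (le_self_add.trans (hu.energy_le hκ.le hγ₀ hd' t))
  obtain ⟨A, hA, hAb⟩ := hCb T hT.le u hu.divFree hD ‖u₀‖ₑ enorm_ne_top hR
  -- The term `1/T` keeps the rate positive even for `u₀ = 0`, and contributes only a factor `exp 1`
  -- to `exp (l * T)`.
  set l : ℝ := (2 * C₁ * ‖u₀‖) ^ (2 / (1 - δ)) + 1 / T
  have hl : 0 < l := by positivity
  obtain ⟨S, hS, hSn⟩ := exists_solution_operator hl.le A (fun y b hb hy t => by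
    have hy' (s : Set.Icc (0 : ℝ) T) :
        ‖y s‖ₑ ≤ ENNReal.ofReal (Real.exp (l * s)) * ENNReal.ofReal b := by
      rw [← ofReal_norm, ← ENNReal.ofReal_mul (Real.exp_pos _).le]
      exact ENNReal.ofReal_le_ofReal (hy s)
    have h1 := hAb y l hl (ENNReal.ofReal b) ENNReal.ofReal_ne_top hy' t
    have h2 : C * ENNReal.ofReal (l ^ (-((1 - δ) / 2))) *
        ((∫⁻ s in Set.Ioc 0 T, sobSq 1 (extPath hT.le u s).1) ^ (1 / 2 : ℝ) + ‖u₀‖ₑ) ≤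
        ENNReal.ofReal (1 / 2) := by
      calc _ ≤ C * ENNReal.ofReal (l ^ (-((1 - δ) / 2))) * (e * ‖u₀‖ₑ + ‖u₀‖ₑ) := by gcongr
        _ = C * (e + 1) * ‖u₀‖ₑ * ENNReal.ofReal (l ^ (-((1 - δ) / 2))) := by ring
        _ ≤ ENNReal.ofReal C₁ * ENNReal.ofReal ‖u₀‖ * ENNReal.ofReal (l ^ (-((1 - δ) / 2))) := by
            rw [ofReal_norm]
            gcongr
            rw [← ENNReal.ofReal_toReal hCe]
            exact ENNReal.ofReal_le_ofReal (by simp only [C₁]; linarith)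
        _ ≤ _ := by
            rw [← ENNReal.ofReal_mul hC₁.le, ← ENNReal.ofReal_mul (by positivity)]
            refine ENNReal.ofReal_le_ofReal ?_
            have h3 := mul_rpow_growth_rate_le (q := 2 / (1 - δ)) hC₁ (norm_nonneg u₀)
              (div_pos two_pos (by linarith)) hT
            rwa [one_div_div] at h3
    have h4 := h1.trans (mul_le_mul' h2 le_rfl)
    rw [← ofReal_norm, ← ENNReal.ofReal_mul (Real.exp_pos _).le,
      ← ENNReal.ofReal_mul (by norm_num)] at h4
    exact (ENNReal.ofReal_le_ofReal_iff (by positivity)).1 h4)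
  exact ⟨S, fun z y => (isLinearizedSolution_iff hA z y).trans (hS y z), hSn⟩

end LerayAlpha

end

/-! ### Choice of the exponents and the main result. -/

theorem proposition5p2 (d : ℕ) (hd : d = 2 ∨ d = 3) (κ γ₀ γ β : ℝ) (hκ : 0 < κ)
    (hγ₀ : ((d : ℝ) - 2) / 4 < γ₀) (hγ₀' : γ₀ < ((d : ℝ) + 2) / 4)
    (hγ : 0 < γ) (hγ' : γ < (d : ℝ) / 2)
    (hβ : (d : ℝ) / 2 - γ < β) (hβ' : β < min (2 * γ₀) ((d : ℝ) / 2)) :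
    ∃ q : ℝ, max 2 (4 / (4 * γ₀ - d + 2)) < q ∧ ∃ C : ℝ, 0 < C ∧ ∃ M : ℝ, 0 < M ∧
      ∀ (T : ℝ) (hT : 0 < T) (u₀ : Sobolev d 0), IsDivFree u₀.1 →
      ∀ u : C(Set.Icc (0 : ℝ) T, Sobolev d 0), IsLerayAlphaSolution κ γ₀ T hT.le u₀ u →
      (∀ z : C(Set.Icc (0 : ℝ) T, Sobolev d (-β)),
        ∃! y : C(Set.Icc (0 : ℝ) T, Sobolev d (-β)),
          IsLinearizedSolution κ γ₀ β T hT.le u z y) ∧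
      ∃ S : C(Set.Icc (0 : ℝ) T, Sobolev d (-β)) →L[ℝ] C(Set.Icc (0 : ℝ) T, Sobolev d (-β)),
        (∀ z, IsLinearizedSolution κ γ₀ β T hT.le u z (S z)) ∧
        ‖S‖ ≤ M * Real.exp (C * (1 + T) * ‖u₀‖ ^ q) := by
  have hν : 0 < viscConst d * κ := by
    unfold viscConst
    split <;> positivity
  have hβ0 : 0 ≤ β := by linarith
  have hβγ : β ≤ 2 * γ₀ := hβ'.le.trans (min_le_left _ _)
  -- `δ₀` is the smoothing deficit of `K`, below `1` by the lower bound on `γ₀`. An admissible pair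
  -- must satisfy `δ - ε > d/2 - 2γ₀` with `0 < ε ≤ δ < 1`. The midpoint `δ` of `δ₀` and `1` with `ε
  -- = (1-δ₀)/4` works, as `δ - ε = (1+3δ₀)/4 > δ₀`.
  set δ₀ : ℝ := max 0 ((d : ℝ) / 2 - 2 * γ₀)
  have hδ₀ : 0 ≤ δ₀ := le_max_left _ _
  have hδ₀' : (d : ℝ) / 2 - 2 * γ₀ ≤ δ₀ := le_max_right _ _
  have hδ₁ : δ₀ < 1 := max_lt one_pos (by linarith)
  obtain ⟨C, hC, h⟩ := exists_linearized_solution_operator (d := d) (κ := κ) (γ₀ := γ₀) (β := β)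
    (δ := (1 + δ₀) / 2) (ε := (1 - δ₀) / 4) hν hβ0 hβγ (by linarith) (by linarith) (by linarith)
    (by linarith) (by linarith)
  -- This is `4/(1-δ₀)`, while the required lower bound is exactly `2/(1-δ₀)`, the limiting value of
  -- `2/(1-δ)` as `δ` decreases to `δ₀`.
  set q : ℝ := 2 / (1 - (1 + δ₀) / 2)
  have hqpos : 0 < 1 - (1 + δ₀) / 2 := by linarith
  refine ⟨q, ?_, (2 * C) ^ q, by positivity, 2 * Real.exp 1, by positivity,
    fun T hT u₀ _ u hu => ?_⟩
  · have hpos : 0 < 4 * γ₀ - d + 2 := by linarith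
    refine max_lt ?_ ?_
    · rw [lt_div_iff₀ hqpos]; linarith
    · rw [div_lt_div_iff₀ hpos hqpos]; linarith
  obtain ⟨S, hS, hSn⟩ := h T hT u₀ u hu
  refine ⟨fun z => ⟨S z, (hS z _).2 rfl, fun y hy => (hS z y).1 hy⟩, S, fun z => (hS z _).2 rfl,
    hSn.trans ?_⟩
  -- The exponent `lT` equals `(2C)^q ‖u₀‖^q T + 1`; the `1` goes into `M`, and `T` is enlarged to
  -- `1 + T`.
  rw [mul_assoc 2 (Real.exp 1), ← Real.exp_add]
  refine mul_le_mul_of_nonneg_left (Real.exp_le_exp.2 ?_) two_pos.le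
  rw [Real.mul_rpow (by positivity) (norm_nonneg _), add_mul, one_div_mul_cancel hT.ne']
  have h1 : 0 ≤ (2 * C) ^ q * ‖u₀‖ ^ q := by positivity
  linarith
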